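/- Let $\mathfrak v,\mathfrak z$ be finite-dimensional Euclidean spaces, $n=\dim\mathfrak v$, $m=\dim\mathfrak z$, and let $J$ be a representation on $\mathfrak v$ of the Clifford algebra of the quadratic form $q(z)=-\langle z,z\rangle$ on $\mathfrak z$ such that $\|J_zv\|=\|z\|\,\|v\|$ for all $z\in\mathfrak z$, $v\in\mathfrak v$. Define $[\cdot,\cdot]\colon\mathfrak v\times\mathfrak v\to\mathfrak z$ by $\langle[v,w],z\rangle=\langle J_zv,w\rangle$. The associated Damek–Ricci space is the half-space $S=\{(v,z,t)\in\mathfrak v\times\mathfrak z\times\mathbb R: t>0\}$ with the Riemannian metric $$\langle(v_1,z_1,t_1),(v_2,z_2,t_2)\rangle_{(\bar v,\bar z,\bar t)}=\frac1{\bar t}\langle v_1,v_2\rangle+\frac1{\bar t^2}\Big\langle z_1+\tfrac12[v_1,\bar v],z_2+\tfrac12[v_2,\bar v]\Big\rangle+\frac{t_1t_2}{\bar t^2}.$$ For $k\ge1$, $\mathbb C\mathbf H^k$ is the Damek–Ricci space with $\mathfrak v=\mathbb C^{k-1}$, $\mathfrak z=\mathbb R$, $J_zv=z\,\mathrm i\,v$,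 and $\mathbb R\mathbf H^k$ is the (degenerate) one with $\mathfrak v=\mathbb R^{k-1}$, $\mathfrak z=0$. "The Damek–Ricci space is $\mathbb C\mathbf H^k$" means that there are linear isometries $\mathfrak v\cong\mathbb C^{k-1}$ and $\mathfrak z\cong\mathbb R$ that intertwine the maps $J$. A real subspace $W\subseteq\mathbb C^{k-1}$ is totally real if $\mathrm iW\perp W$, and maximal totally real if it is maximal, with respect to inclusion, among such subspaces. A smooth function $F\colon S\to\mathbb R$ is transnormal if $\|\nabla F\|^2=b\circ F$ for some $C^2$ function $b\colon F(S)\to\mathbb R$, and isoparametric if, in addition, $\Delta F=a\circ F$ for some continuous function $a\colon F(S)\to\mathbb R$. Let $\mathfrak v=\mathfrak v_1\oplus\mathfrak v_2$ be an orthogonal decomposition with orthogonal projections $\Pi_1,\Pi_2$, and let $$F(v,z,t)=\frac{\left(t+\frac12\|\Pi_2v\|^2\right)^2+\left\|z-\frac12[\Pi_1v,\Pi_2v]\right\|^2}{t^2}\qquad((v,z,t)\in S).$$ (i) $F$ is transnormal if and only if $J_z\mathfrak v_1\subseteq\mathfrak v_2$ and $J_z\mathfrak v_2\subseteq\mathfrak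 v_1$ for all $z\in\mathfrak z$. (ii) Assume $m\neq0$, and $n\ne0$ or $m=1$. Then $F$ is isoparametric if and only if, for some $k\ge1$, the Damek–Ricci space is $\mathbb C\mathbf H^k$ and $\mathfrak v_1$ is a maximal totally real subspace of $\mathfrak v=\mathbb C^{k-1}$. In this case the set $N=\{(v,0,t)\in S: v\in\mathfrak v_1\}$ is the image of $\mathbb R\mathbf H^k$ under a map that preserves Riemannian distances, $F\ge1$, and for every $r\ge0$ the level set $\{F=\cosh^2r\}$ is the tube of radius $r$ about $N$, i.e. the set of points of $S$ at Riemannian distance $r$ from $N$. -/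

import Mathlib

open scoped InnerProductSpace ContDiff

noncomputable section

/-! ### Riemannian calculus on an open subset of a finite-dimensional vector space

A Riemannian metric on an open set of `E` is given as `g : E → E → E → ℝ`, where `g p X Y` is the
inner product of the tangent vectors `X`, `Y` at `p`. -/

namespace Riem

variable {E : Type*} [NormedAddCommGroup E] [NormedSpace ℝ E]
variable {ι : Type*} [Fintype ι] [DecidableEq ι]

/-- The matrix `g_{ij}` of the metric at `p` in the coordinates given by the basis `b`. -/
def gram (g : E → E → E → ℝ) (b : Module.Basis ι ℝ E) (p : E) : Matrix ι ι ℝ :=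
  Matrix.of fun i j => g p (b i) (b j)

/-- The gradient `∑ g^{ij} (∂_j F) ∂_i`. -/
def gradient (g : E → E → E → ℝ) (b : Module.Basis ι ℝ E) (F : E → ℝ) (p : E) : E :=
  ∑ i, (∑ j, (gram g b p)⁻¹ i j * fderiv ℝ F p (b j)) • b i

/-- The squared Riemannian length of the gradient. -/
def gradNormSq (g : E → E → E → ℝ) (b : Module.Basis ι ℝ E) (F : E → ℝ) (p : E) : ℝ :=
  g p (gradient g b F p) (gradient g b F p)

/-- The Riemannian volume density `√(det g_{ij})`. -/
def volDensity (g : E → E → E → ℝ) (b : Module.Basis ι ℝ E) (p : E) : ℝ :=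
  Real.sqrt (gram g b p).det

/-- The Laplace–Beltrami operator
`(det g)^{-1/2} ∑ ∂_i ((det g)^{1/2} (grad F)^i)`, the divergence of the gradient. -/
def laplacian (g : E → E → E → ℝ) (b : Module.Basis ι ℝ E) (F : E → ℝ) (p : E) : ℝ :=
  (volDensity g b p)⁻¹ *
    ∑ i, fderiv ℝ (fun q => volDensity g b q * b.repr (gradient g b F q) i) p (b i)

/-- A smooth function on `U` with `‖∇F‖² = β ∘ F` for a `C²` function `β` on the image of `F`. -/
def IsTransnormal (g : E → E → E → ℝ) (b : Module.Basis ι ℝ E) (U : Set E) (F : E → ℝ) : Prop :=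
  ContDiffOn ℝ ∞ F U ∧
    ∃ β : ℝ → ℝ, ContDiffOn ℝ 2 β (F '' U) ∧ ∀ p ∈ U, gradNormSq g b F p = β (F p)

/-- A transnormal function on `U` with `ΔF = α ∘ F` for a continuous function `α` on the image
of `F`. -/
def IsIsoparametric (g : E → E → E → ℝ) (b : Module.Basis ι ℝ E) (U : Set E) (F : E → ℝ) : Prop :=
  IsTransnormal g b U F ∧
    ∃ α : ℝ → ℝ, ContinuousOn α (F '' U) ∧ ∀ p ∈ U, laplacian g b F p = α (F p)

/-- The Riemannian length of a curve `[0,1] → E`. -/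
def curveLength (g : E → E → E → ℝ) (γ : ℝ → E) : ℝ :=
  ∫ s in (0 : ℝ)..1, Real.sqrt
    (g (γ s) (derivWithin γ (Set.Icc 0 1) s) (derivWithin γ (Set.Icc 0 1) s))

/-- The Riemannian distance in `U`: the infimum of the lengths of the `C¹` curves in `U` that
connect two points. -/
def dist (g : E → E → E → ℝ) (U : Set E) (p q : E) : ℝ :=
  sInf {L : ℝ | ∃ γ : ℝ → E, ContDiffOn ℝ 1 γ (Set.Icc 0 1) ∧ (∀ s ∈ Set.Icc (0 : ℝ) 1, γ s ∈ U) ∧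
    γ 0 = p ∧ γ 1 = q ∧ L = curveLength g γ}

/-- The tube of radius `r` about a non-empty subset `N` of `U`: the points of `U` at Riemannian
distance `r` from `N`. -/
def tube (g : E → E → E → ℝ) (U N : Set E) (r : ℝ) : Set E :=
  {p ∈ U | sInf ((fun q => dist g U p q) '' N) = r}

end Riem

/-! ### Damek–Ricci spaces in the half-space model -/

/-- The quadratic form `q(z) = -⟨z, z⟩`. -/
def negNormSqForm (Z : Type*) [NormedAddCommGroup Z] [InnerProductSpace ℝ Z] :
    QuadraticForm ℝ Z :=
  -(LinearMap.BilinMap.toQuadraticMap (innerₗ Z))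

theorem negNormSqForm_apply {Z : Type*} [NormedAddCommGroup Z] [InnerProductSpace ℝ Z] (z : Z) :
    negNormSqForm Z z = -⟪z, z⟫_ℝ := rfl

/-- The algebraic data of a Damek–Ricci space: a representation of the Clifford algebra
`Cl(Z, q)`, `q(z) = -⟨z, z⟩`, on `V` such that `‖J_z v‖ = ‖z‖ ‖v‖`. -/
structure DamekRicci (V Z : Type*) [NormedAddCommGroup V] [InnerProductSpace ℝ V]
    [NormedAddCommGroup Z] [InnerProductSpace ℝ Z] where
  rep : CliffordAlgebra (negNormSqForm Z) →ₐ[ℝ] Module.End ℝ V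
  norm_rep : ∀ (z : Z) (v : V), ‖rep (CliffordAlgebra.ι (negNormSqForm Z) z) v‖ = ‖z‖ * ‖v‖

namespace DamekRicci

section

variable {V Z : Type*} [NormedAddCommGroup V] [InnerProductSpace ℝ V]
  [NormedAddCommGroup Z] [InnerProductSpace ℝ Z]

/-- The map `z ↦ J_z`. -/
def J (D : DamekRicci V Z) : Z →ₗ[ℝ] V →ₗ[ℝ] V :=
  D.rep.toLinearMap ∘ₗ CliffordAlgebra.ι (negNormSqForm Z)

variable [FiniteDimensional ℝ V] [FiniteDimensional ℝ Z]

/-- The Lie bracket `V × V → Z`, see `inner_bracket`. -/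
def bracket (D : DamekRicci V Z) (x y : V) : Z :=
  LinearMap.adjoint (D.J.flip x) y

/-- The defining property `⟨[x, y], z⟩ = ⟨J_z x, y⟩` of the bracket. -/
theorem inner_bracket (D : DamekRicci V Z) (x y : V) (z : Z) :
    ⟪D.bracket x y, z⟫_ℝ = ⟪D.J z x, y⟫_ℝ := by
  rw [bracket, LinearMap.adjoint_inner_left, LinearMap.flip_apply, real_inner_comm]

/-- The left invariant metric of the Damek–Ricci space at the point `p = (v, z, t)` of the
half-space model. -/
def metric (D : DamekRicci V Z) (p X Y : V × Z × ℝ) : ℝ :=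
  1 / p.2.2 * ⟪X.1, Y.1⟫_ℝ +
    1 / p.2.2 ^ 2 * ⟪X.2.1 + (1 / 2 : ℝ) • D.bracket X.1 p.1,
      Y.2.1 + (1 / 2 : ℝ) • D.bracket Y.1 p.1⟫_ℝ +
    X.2.2 * Y.2.2 / p.2.2 ^ 2

end

/-- The half-space `{(v, z, t) : t > 0}`. -/
def halfSpace (V Z : Type*) : Set (V × Z × ℝ) := {p | 0 < p.2.2}

/-- Linear coordinates on `V × Z × ℝ` from orthonormal bases of `V` and `Z`. -/
def coords (V Z : Type*) [NormedAddCommGroup V] [InnerProductSpace ℝ V] [FiniteDimensional ℝ V]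
    [NormedAddCommGroup Z] [InnerProductSpace ℝ Z] [FiniteDimensional ℝ Z] :
    Module.Basis (Fin (Module.finrank ℝ V) ⊕ Fin (Module.finrank ℝ Z) ⊕ Unit) ℝ (V × Z × ℝ) :=
  (stdOrthonormalBasis ℝ V).toBasis.prod
    ((stdOrthonormalBasis ℝ Z).toBasis.prod (Module.Basis.singleton Unit ℝ))

/-- An isomorphism of the data of Damek–Ricci spaces. -/
structure Iso {V Z V' Z' : Type*} [NormedAddCommGroup V] [InnerProductSpace ℝ V]
    [NormedAddCommGroup Z] [InnerProductSpace ℝ Z] [NormedAddCommGroup V'] [InnerProductSpace ℝ V']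
    [NormedAddCommGroup Z'] [InnerProductSpace ℝ Z']
    (D : DamekRicci V Z) (D' : DamekRicci V' Z') where
  mapV : V ≃ₗᵢ[ℝ] V'
  mapZ : Z ≃ₗᵢ[ℝ] Z'
  map_J : ∀ (z : Z) (v : V), mapV (D.J z v) = D'.J (mapZ z) (mapV v)

/-- An isomorphism of the data induces an isometry `(v, z, t) ↦ (φ v, ψ z, t)` of the half-space
models. -/
theorem Iso.metric_eq {V Z V' Z' : Type*} [NormedAddCommGroup V] [InnerProductSpace ℝ V]
    [NormedAddCommGroup Z] [InnerProductSpace ℝ Z] [NormedAddCommGroup V'] [InnerProductSpace ℝ V']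
    [NormedAddCommGroup Z'] [InnerProductSpace ℝ Z'] [FiniteDimensional ℝ V]
    [FiniteDimensional ℝ Z] [FiniteDimensional ℝ V'] [FiniteDimensional ℝ Z']
    {D : DamekRicci V Z} {D' : DamekRicci V' Z'} (e : Iso D D') (p X Y : V × Z × ℝ) :
    D'.metric (e.mapV p.1, e.mapZ p.2.1, p.2.2) (e.mapV X.1, e.mapZ X.2.1, X.2.2)
      (e.mapV Y.1, e.mapZ Y.2.1, Y.2.2) = D.metric p X Y := by
  have hb : ∀ x y : V, D'.bracket (e.mapV x) (e.mapV y) = e.mapZ (D.bracket x y) := by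
    intro x y
    refine ext_inner_right ℝ fun w => ?_
    obtain ⟨z, rfl⟩ := e.mapZ.surjective w
    rw [inner_bracket, ← e.map_J, LinearIsometryEquiv.inner_map_map,
      LinearIsometryEquiv.inner_map_map, inner_bracket]
  simp only [metric, hb, ← map_smul, ← map_add, LinearIsometryEquiv.inner_map_map]

/-- Multiplication by the imaginary unit on `ℂ^d`. -/
def mulI (d : ℕ) : EuclideanSpace ℂ (Fin d) →ₗ[ℝ] EuclideanSpace ℂ (Fin d) :=
  (LinearMap.lsmul ℂ (EuclideanSpace ℂ (Fin d)) Complex.I).restrictScalars ℝ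

theorem mulI_apply (d : ℕ) (v : EuclideanSpace ℂ (Fin d)) : mulI d v = Complex.I • v := rfl

theorem mulI_aux (d : ℕ) (z : ℝ) :
    LinearMap.toSpanSingleton ℝ (Module.End ℝ (EuclideanSpace ℂ (Fin d))) (mulI d) z *
      LinearMap.toSpanSingleton ℝ (Module.End ℝ (EuclideanSpace ℂ (Fin d))) (mulI d) z =
      algebraMap ℝ _ (negNormSqForm ℝ z) := by
  refine LinearMap.ext fun v => ?_
  rw [Module.algebraMap_end_apply, negNormSqForm_apply]
  simp only [LinearMap.toSpanSingleton_apply, Module.End.mul_apply, LinearMap.smul_apply,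
    mulI_apply]
  ext i
  simp
  linear_combination (z : ℂ) ^ 2 * v i * Complex.I_sq

/-- The complex hyperbolic space `ℂH^k`, `k ≥ 1`, as a Damek–Ricci space: `V = ℂ^{k-1}`, `Z = ℝ`
and `J_z v = z i v`. -/
def complexHyperbolic (k : ℕ) : DamekRicci (EuclideanSpace ℂ (Fin (k - 1))) ℝ where
  rep := CliffordAlgebra.lift (negNormSqForm ℝ)
    ⟨LinearMap.toSpanSingleton ℝ (Module.End ℝ (EuclideanSpace ℂ (Fin (k - 1)))) (mulI (k - 1)),
      mulI_aux (k - 1)⟩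
  norm_rep z v := by
    rw [CliffordAlgebra.lift_ι_apply]
    simp [mulI_apply, norm_smul]

theorem complexHyperbolic_J (k : ℕ) (z : ℝ) (v : EuclideanSpace ℂ (Fin (k - 1))) :
    (complexHyperbolic k).J z v = z • Complex.I • v := by
  simp [J, complexHyperbolic, mulI_apply]

/-- The real hyperbolic space `ℝH^k`, `k ≥ 1`, as a degenerate Damek–Ricci space: `V = ℝ^{k-1}`
and `Z = 0`. -/
def realHyperbolic (k : ℕ) :
    DamekRicci (EuclideanSpace ℝ (Fin (k - 1))) (EuclideanSpace ℝ (Fin 0)) where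
  rep := CliffordAlgebra.lift (negNormSqForm (EuclideanSpace ℝ (Fin 0)))
    ⟨0, fun z => by rw [Subsingleton.elim z 0]; simp⟩
  norm_rep z v := by
    rw [Subsingleton.elim z 0]; simp

/-- A real subspace `W` of `ℂ^d` is totally real if `i W` is orthogonal to `W`. -/
def IsTotallyReal {d : ℕ} (W : Submodule ℝ (EuclideanSpace ℂ (Fin d))) : Prop :=
  ∀ x ∈ W, ∀ y ∈ W, ⟪Complex.I • x, y⟫_ℝ = 0

/-- `e` identifies the Damek–Ricci space `D` with `ℂH^k` so that `v₁` is a maximal totally real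
subspace of `V = ℂ^{k-1}`. -/
def IsMaximalTotallyReal {V Z : Type*} [NormedAddCommGroup V] [InnerProductSpace ℝ V]
    [NormedAddCommGroup Z] [InnerProductSpace ℝ Z] {D : DamekRicci V Z} {k : ℕ}
    (e : Iso D (complexHyperbolic k)) (v₁ : Submodule ℝ V) : Prop :=
  Maximal IsTotallyReal (v₁.map e.mapV.toLinearEquiv.toLinearMap)

section

variable {V Z : Type*} [NormedAddCommGroup V] [InnerProductSpace ℝ V] [FiniteDimensional ℝ V]
  [NormedAddCommGroup Z] [InnerProductSpace ℝ Z] [FiniteDimensional ℝ Z]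

/-- The function `F = ((t + ½‖Π₂ v‖²)² + ‖z - ½[Π₁ v, Π₂ v]‖²) / t²`. -/
def quarticF (D : DamekRicci V Z) (v₁ v₂ : Submodule ℝ V) (p : V × Z × ℝ) : ℝ :=
  ((p.2.2 + 1 / 2 * ‖v₂.starProjection p.1‖ ^ 2) ^ 2 +
    ‖p.2.1 - (1 / 2 : ℝ) • D.bracket (v₁.starProjection p.1) (v₂.starProjection p.1)‖ ^ 2) /
    p.2.2 ^ 2

/-- `F` is transnormal on the Damek–Ricci space. -/
def IsTransnormal (D : DamekRicci V Z) (F : V × Z × ℝ → ℝ) : Prop :=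
  Riem.IsTransnormal D.metric (coords V Z) (halfSpace V Z) F

/-- `F` is isoparametric on the Damek–Ricci space. -/
def IsIsoparametric (D : DamekRicci V Z) (F : V × Z × ℝ → ℝ) : Prop :=
  Riem.IsIsoparametric D.metric (coords V Z) (halfSpace V Z) F

/-- The Riemannian distance of the Damek–Ricci space. -/
def dist (D : DamekRicci V Z) (p q : V × Z × ℝ) : ℝ :=
  Riem.dist D.metric (halfSpace V Z) p q

/-- The tube of radius `r` about `N` in the Damek–Ricci space. -/
def tube (D : DamekRicci V Z) (N : Set (V × Z × ℝ)) (r : ℝ) : Set (V × Z × ℝ) :=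
  Riem.tube D.metric (halfSpace V Z) N r

/-- The subset `{(v, 0, t) : v ∈ W, t > 0}` of the half-space. -/
def slice (Z : Type*) [NormedAddCommGroup Z] (W : Submodule ℝ V) : Set (V × Z × ℝ) :=
  {p ∈ halfSpace V Z | p.1 ∈ W ∧ p.2.1 = 0}

/-- `N` is a copy of `ℝH^k` in the Damek–Ricci space: the image of `ℝH^k` under a map that
preserves the Riemannian distances of the two spaces. -/
def IsRealHyperbolicSubspace (D : DamekRicci V Z) (k : ℕ) (N : Set (V × Z × ℝ)) : Prop :=
  ∃ f : EuclideanSpace ℝ (Fin (k - 1)) × EuclideanSpace ℝ (Fin 0) × ℝ → V × Z × ℝ,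
    f '' halfSpace _ _ = N ∧
      ∀ p ∈ halfSpace _ _, ∀ q ∈ halfSpace _ _, D.dist (f p) (f q) = (realHyperbolic k).dist p q

end

end DamekRicci

end

/-!
Write `W = 𝔳₁`, `A = t + ½‖Π₂v‖²` and `B = z - ½[Π₁v, Π₂v]`, so that `F = (A² + ‖B‖²) / t²`. Then
`‖∇F‖² = 4F(F - 1) + δ / t³` with a defect `δ` that is a polynomial in the `W`- and `Wᗮ`-components
of `J_B Π₁v` and `J_B Π₂v`. Every level set of `F` contains a point `(0, w, 1)`, where `δ = 0`, so
`F` is transnormal only if `δ` vanishes identically; at the points `(v, z, 1)` with `v ∈ W` or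
`v ∈ Wᗮ` this says that the operators `J_z` interchange `W` and `Wᗮ`.

If they do, then `ΔF = (n + 2m + 4)F - 4 + (m - 1)‖Π₂v‖² / t`, and the last term is constant on the
level sets only if `m = 1` or `𝔳 = 0`. For `m = 1` the operator `J_z` with `‖z‖ = 1` is a complex
structure, and a subspace that it interchanges with its complement is the same as a maximal totally
real one.

By the equation `‖∇F‖² = 4F(F - 1)` the function `arcosh √F` is `1`-Lipschitz. As it vanishes on
`N`, it is a lower bound for the distance to `N`, and each point is joined to `N` by a geodesic of
exactly this length.
-/

noncomputable section

/-! ### Linear algebra -/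

section LinearAlgebra

theorem orthogonal_eq_of_isOrtho_of_sup_eq_top {𝕜 E : Type*} [RCLike 𝕜] [NormedAddCommGroup E]
    [InnerProductSpace 𝕜 E] {U W : Submodule 𝕜 E} (horth : U ⟂ W) (hsup : U ⊔ W = ⊤) : Uᗮ = W :=
  (eq_of_le_of_inf_le_of_sup_le (z := U) horth.symm.le
    (by rw [inf_comm, U.inf_orthogonal_eq_bot]; exact bot_le)
    (by rw [sup_comm W, hsup]; exact le_top)).symm

theorem trace_prod_eq_add {R M N : Type*} [CommRing R] [AddCommGroup M] [Module R M]
    [Module.Free R M] [Module.Finite R M] [AddCommGroup N] [Module R N] [Module.Free R N]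
    [Module.Finite R N] (f : M × N →ₗ[R] M × N) :
    LinearMap.trace R (M × N) f =
      LinearMap.trace R M (LinearMap.fst R M N ∘ₗ f ∘ₗ LinearMap.inl R M N) +
        LinearMap.trace R N (LinearMap.snd R M N ∘ₗ f ∘ₗ LinearMap.inr R M N) := by
  have h : f = (f ∘ₗ LinearMap.inl R M N) ∘ₗ LinearMap.fst R M N +
      (f ∘ₗ LinearMap.inr R M N) ∘ₗ LinearMap.snd R M N := by
    refine LinearMap.ext fun x => ?_
    simp [← map_add]
  conv_lhs => rw [h]
  rw [map_add, LinearMap.trace_comp_comm', LinearMap.trace_comp_comm' _ (LinearMap.snd R M N)]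

variable {E : Type*} [NormedAddCommGroup E] [InnerProductSpace ℝ E] [FiniteDimensional ℝ E]

theorem trace_starProjection (W : Submodule ℝ E) :
    LinearMap.trace ℝ E W.starProjection = Module.finrank ℝ W :=
  LinearMap.IsProj.trace
    ⟨W.starProjection_apply_mem, fun _ hx => W.starProjection_eq_self_iff.2 hx⟩

theorem inner_starProjection_self (W : Submodule ℝ E) (v : E) :
    ⟪v, W.starProjection v⟫_ℝ = ‖W.starProjection v‖ ^ 2 := by
  rw [← real_inner_self_eq_norm_sq, Submodule.inner_starProjection_left_eq_right,
    W.starProjection_eq_self_iff.2 (W.starProjection_apply_mem v)]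

end LinearAlgebra

/-! ### The Clifford action and the bracket -/

namespace DamekRicci

section Clifford

variable {V Z : Type*} [NormedAddCommGroup V] [InnerProductSpace ℝ V]
  [NormedAddCommGroup Z] [InnerProductSpace ℝ Z] (D : DamekRicci V Z)

theorem norm_J (z : Z) (v : V) : ‖D.J z v‖ = ‖z‖ * ‖v‖ := D.norm_rep z v

theorem J_J (z : Z) (v : V) : D.J z (D.J z v) = -(‖z‖ ^ 2) • v := by
  have h := congrArg (fun a => D.rep a v) (CliffordAlgebra.ι_sq_scalar (negNormSqForm Z) z)
  simp only [map_mul, Module.End.mul_apply, AlgHom.commutes, Module.algebraMap_end_apply,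
    negNormSqForm_apply, real_inner_self_eq_norm_sq] at h
  exact h

theorem inner_J_J (z : Z) (v w : V) : ⟪D.J z v, D.J z w⟫_ℝ = ‖z‖ ^ 2 * ⟪v, w⟫_ℝ := by
  simp only [real_inner_eq_norm_add_mul_self_sub_norm_mul_self_sub_norm_mul_self_div_two,
    ← map_add, norm_J]
  ring

theorem inner_J_J_same (z w : Z) (v : V) : ⟪D.J z v, D.J w v⟫_ℝ = ⟪z, w⟫_ℝ * ‖v‖ ^ 2 := by
  simp only [real_inner_eq_norm_add_mul_self_sub_norm_mul_self_sub_norm_mul_self_div_two,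
    ← LinearMap.add_apply, ← map_add, norm_J]
  ring

theorem inner_J_left (z : Z) (v w : V) : ⟪D.J z v, w⟫_ℝ = -⟪v, D.J z w⟫_ℝ := by
  rcases eq_or_ne z 0 with rfl | hz
  · simp
  have h := D.inner_J_J z v (D.J z w)
  rw [J_J, inner_smul_right] at h
  refine mul_left_cancel₀ (pow_ne_zero 2 (norm_ne_zero_iff.2 hz)) ?_
  linarith

theorem inner_J_self (z : Z) (v : V) : ⟪D.J z v, v⟫_ℝ = 0 := by
  have h := D.inner_J_left z v v
  rw [real_inner_comm (D.J z v) v] at h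
  linarith

/-- Every `J_z` interchanges the subspace `W` and its orthogonal complement. -/
def Swaps (W : Submodule ℝ V) : Prop :=
  (∀ z : Z, ∀ v ∈ W, D.J z v ∈ Wᗮ) ∧ (∀ z : Z, ∀ v ∈ Wᗮ, D.J z v ∈ W)

namespace Swaps

variable [FiniteDimensional ℝ V] {D} {W : Submodule ℝ V} (hJ : D.Swaps W)
include hJ

theorem starProjection_J (z : Z) {y : V} (hy : y ∈ Wᗮ) : W.starProjection (D.J z y) = D.J z y :=
  W.starProjection_eq_self_iff.2 (hJ.2 z y hy)

theorem starProjection_orthogonal_J (z : Z) {y : V} (hy : y ∈ Wᗮ) :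
    Wᗮ.starProjection (D.J z y) = 0 :=
  Submodule.starProjection_orthogonal_apply_eq_zero (hJ.2 z y hy)

theorem trace_J_comp_starProjection (z : Z) :
    LinearMap.trace ℝ V (D.J z ∘ₗ Wᗮ.starProjection) = 0 := by
  have h : D.J z ∘ₗ (Wᗮ.starProjection : V →ₗ[ℝ] V) =
      W.starProjection ∘ₗ D.J z ∘ₗ Wᗮ.starProjection :=
    LinearMap.ext fun v => (hJ.starProjection_J z (Wᗮ.starProjection_apply_mem v)).symm
  have h' : (Wᗮ.starProjection : V →ₗ[ℝ] V) ∘ₗ W.starProjection = 0 :=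
    LinearMap.ext fun v => Submodule.starProjection_orthogonal_apply_eq_zero
      (W.starProjection_apply_mem v)
  rw [h, LinearMap.trace_comp_comm', LinearMap.comp_assoc, h', LinearMap.comp_zero, map_zero]

end Swaps

end Clifford

variable {V Z : Type*} [NormedAddCommGroup V] [InnerProductSpace ℝ V] [FiniteDimensional ℝ V]
  [NormedAddCommGroup Z] [InnerProductSpace ℝ Z] [FiniteDimensional ℝ Z] (D : DamekRicci V Z)

/-- The Clifford action as a continuous bilinear map. -/
def JL : Z →L[ℝ] V →L[ℝ] V := D.J.toContinuousBilinearMap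

@[simp]
theorem JL_apply (z : Z) (v : V) : D.JL z v = D.J z v := rfl

/-- The bracket as a continuous bilinear map. -/
def bracketL : V →L[ℝ] V →L[ℝ] Z :=
  (LinearMap.mk₂ ℝ D.bracket (by simp [bracket]) (by simp [bracket]) (by simp [bracket])
    (by simp [bracket])).toContinuousBilinearMap

@[simp]
theorem bracketL_apply (x y : V) : D.bracketL x y = D.bracket x y := rfl

theorem bracket_add_left (x x' y : V) : D.bracket (x + x') y = D.bracket x y + D.bracket x' y := by
  simp only [← bracketL_apply, map_add, _root_.add_apply]

theorem bracket_add_right (x y y' : V) :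
    D.bracket x (y + y') = D.bracket x y + D.bracket x y' := by
  simp only [← bracketL_apply, map_add]

theorem bracket_sub_left (x x' y : V) : D.bracket (x - x') y = D.bracket x y - D.bracket x' y := by
  simp only [← bracketL_apply, map_sub, _root_.sub_apply]

theorem bracket_smul_left (c : ℝ) (x y : V) : D.bracket (c • x) y = c • D.bracket x y := by
  simp only [← bracketL_apply, map_smul, _root_.smul_apply]

theorem bracket_smul_right (c : ℝ) (x y : V) : D.bracket x (c • y) = c • D.bracket x y := by
  simp only [← bracketL_apply, map_smul]

@[simp]
theorem bracket_zero_left (y : V) : D.bracket 0 y = 0 := by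
  simp only [← bracketL_apply, map_zero, _root_.zero_apply]

@[simp]
theorem bracket_zero_right (x : V) : D.bracket x 0 = 0 := by
  simp only [← bracketL_apply, map_zero]

theorem bracket_swap (x y : V) : D.bracket x y = -D.bracket y x :=
  ext_inner_right ℝ fun z => by
    rw [inner_neg_left, inner_bracket, inner_bracket, inner_J_left, real_inner_comm]

theorem inner_bracket_right (x y : V) (z : Z) : ⟪z, D.bracket x y⟫_ℝ = ⟪D.J z x, y⟫_ℝ := by
  rw [real_inner_comm, inner_bracket]

theorem bracket_J_self (z : Z) (v : V) : D.bracket (D.J z v) v = -(‖v‖ ^ 2) • z :=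
  ext_inner_right ℝ fun w => by
    rw [inner_bracket, inner_J_left, inner_J_J_same, real_inner_smul_left, neg_mul, mul_comm]

theorem trace_bracket_comp_J (x y : V) :
    LinearMap.trace ℝ Z ((D.bracketL x).toLinearMap ∘ₗ D.J.flip y) =
      Module.finrank ℝ Z * ⟪x, y⟫_ℝ := by
  rw [LinearMap.trace_eq_sum_inner _ (stdOrthonormalBasis ℝ Z)]
  simp [inner_bracket_right, inner_J_J]

namespace Swaps

variable {D} {W : Submodule ℝ V} (hJ : D.Swaps W)
include hJ

theorem bracket_eq_zero {x x' : V} (hx : x ∈ W) (hx' : x' ∈ W) : D.bracket x x' = 0 :=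
  ext_inner_right ℝ fun z => by
    rw [inner_bracket, inner_zero_left]
    exact Submodule.inner_left_of_mem_orthogonal hx' (hJ.1 z x hx)

theorem bracket_orthogonal_eq_zero {y y' : V} (hy : y ∈ Wᗮ) (hy' : y' ∈ Wᗮ) :
    D.bracket y y' = 0 :=
  ext_inner_right ℝ fun z => by
    rw [inner_bracket, inner_zero_left]
    exact Submodule.inner_right_of_mem_orthogonal (hJ.2 z y hy) hy'

end Swaps

end DamekRicci

namespace Riem

/-! ### Gradients, Laplacians and distances in coordinates -/

section Calculus

variable {E : Type*} [NormedAddCommGroup E] [NormedSpace ℝ E] {ι : Type*} [Fintype ι]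
  [DecidableEq ι] {g : E → E → E → ℝ} {b : Module.Basis ι ℝ E} {F : E → ℝ} {p : E}

theorem gram_eq_toMatrix {B : LinearMap.BilinForm ℝ E} (hB : ∀ X Y, B X Y = g p X Y) :
    gram g b p = LinearMap.BilinForm.toMatrix b B := by
  ext i j
  rw [LinearMap.BilinForm.toMatrix_apply, hB]
  rfl

theorem gradient_eq {B : LinearMap.BilinForm ℝ E} (hB : ∀ X Y, B X Y = g p X Y)
    (hsymm : ∀ X Y, B X Y = B Y X) (hdet : (gram g b p).det ≠ 0) {G : E}
    (hG : ∀ X, g p G X = fderiv ℝ F p X) : gradient g b F p = G := by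
  have h : (gram g b p).mulVec (b.repr G) = fun j => fderiv ℝ F p (b j) := by
    funext j
    rw [← hG (b j), ← hB, hsymm]
    conv_rhs => rw [← b.sum_repr G, map_sum]
    refine Finset.sum_congr rfl fun i _ => ?_
    rw [map_smul, hB, smul_eq_mul, mul_comm]
    rfl
  have h' : (gram g b p)⁻¹.mulVec (fun j => fderiv ℝ F p (b j)) = b.repr G := by
    rw [← h, Matrix.mulVec_mulVec, Matrix.nonsing_inv_mul _ hdet.isUnit, Matrix.one_mulVec]
  rw [gradient]
  conv_rhs => rw [← b.sum_repr G]
  refine Finset.sum_congr rfl fun i _ => ?_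
  rw [← congrFun h' i]
  rfl

theorem laplacian_eq_trace {G : E → E} (hG : gradient g b F =ᶠ[nhds p] G)
    (hGd : DifferentiableAt ℝ G p) (hvd : DifferentiableAt ℝ (volDensity g b) p)
    (hv : volDensity g b p ≠ 0) :
    laplacian g b F p = LinearMap.trace ℝ E (fderiv ℝ G p) +
      (volDensity g b p)⁻¹ * fderiv ℝ (volDensity g b) p (G p) := by
  have : FiniteDimensional ℝ E := b.finiteDimensional_of_finite
  have hterm : ∀ i, fderiv ℝ (fun q => volDensity g b q * b.repr (gradient g b F q) i) p (b i) =
      volDensity g b p * b.repr (fderiv ℝ G p (b i)) i +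
        b.repr (G p) i * fderiv ℝ (volDensity g b) p (b i) := fun i => by
    have hr : HasFDerivAt (fun q => b.repr (G q) i)
        ((LinearMap.toContinuousLinearMap (b.coord i)).comp (fderiv ℝ G p)) p :=
      (LinearMap.toContinuousLinearMap (b.coord i)).hasFDerivAt.comp p hGd.hasFDerivAt
    have he : (fun q => volDensity g b q * b.repr (gradient g b F q) i) =ᶠ[nhds p]
        fun q => volDensity g b q * b.repr (G q) i := by
      filter_upwards [hG] with q hq
      rw [hq]
    have hm : HasFDerivAt (fun q => volDensity g b q * b.repr (G q) i) _ p :=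
      hvd.hasFDerivAt.mul hr
    rw [he.fderiv_eq, hm.fderiv]
    rfl
  have htrace : LinearMap.trace ℝ E (fderiv ℝ G p) = ∑ i, b.repr (fderiv ℝ G p (b i)) i := by
    simp [LinearMap.trace_eq_matrix_trace ℝ b, Matrix.trace, LinearMap.toMatrix_apply]
  have hsum : ∑ i, b.repr (G p) i * fderiv ℝ (volDensity g b) p (b i) =
      fderiv ℝ (volDensity g b) p (G p) := by
    conv_rhs => rw [← b.sum_repr (G p), map_sum]
    simp only [map_smul, smul_eq_mul]
  rw [laplacian, htrace, ← hsum]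
  simp_rw [hterm]
  rw [Finset.sum_add_distrib, ← Finset.mul_sum, mul_add, inv_mul_cancel_left₀ hv]

end Calculus

section Distance

variable {E : Type*} [NormedAddCommGroup E] [NormedSpace ℝ E] {g : E → E → E → ℝ} {U : Set E}
  {γ : ℝ → E} {p q : E}

/-- The `C¹` curves `[0,1] → U` that compete in the definition of the distance. -/
def IsCurveIn (U : Set E) (γ : ℝ → E) : Prop :=
  ContDiffOn ℝ 1 γ (Set.Icc 0 1) ∧ ∀ s ∈ Set.Icc (0 : ℝ) 1, γ s ∈ U

/-- The integrand of `Riem.curveLength`. -/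
def speed (g : E → E → E → ℝ) (γ : ℝ → E) (s : ℝ) : ℝ :=
  √(g (γ s) (derivWithin γ (Set.Icc 0 1) s) (derivWithin γ (Set.Icc 0 1) s))

theorem curveLength_eq (g : E → E → E → ℝ) (γ : ℝ → E) :
    curveLength g γ = ∫ s in (0 : ℝ)..1, speed g γ s := rfl

theorem speed_nonneg (g : E → E → E → ℝ) (γ : ℝ → E) (s : ℝ) : 0 ≤ speed g γ s :=
  Real.sqrt_nonneg _

theorem curveLength_nonneg (g : E → E → E → ℝ) (γ : ℝ → E) : 0 ≤ curveLength g γ :=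
  intervalIntegral.integral_nonneg zero_le_one fun s _ => speed_nonneg g γ s

theorem IsCurveIn.hasDerivWithinAt (hγ : IsCurveIn U γ) {s : ℝ} (hs : s ∈ Set.Icc (0 : ℝ) 1) :
    HasDerivWithinAt γ (derivWithin γ (Set.Icc 0 1) s) (Set.Icc 0 1) s :=
  ((hγ.1.differentiableOn one_ne_zero) s hs).hasDerivWithinAt

theorem IsCurveIn.continuousOn_speed (hγ : IsCurveIn U γ)
    (hg : ContinuousOn (fun x : E × E => g x.1 x.2 x.2) (U ×ˢ Set.univ)) :
    ContinuousOn (speed g γ) (Set.Icc 0 1) :=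
  (hg.comp (hγ.1.continuousOn.prodMk
    (hγ.1.continuousOn_derivWithin (uniqueDiffOn_Icc one_pos) le_rfl))
    fun s hs => ⟨hγ.2 s hs, trivial⟩).sqrt

theorem dist_le_curveLength (hγ : IsCurveIn U γ) (h0 : γ 0 = p) (h1 : γ 1 = q) :
    dist g U p q ≤ curveLength g γ :=
  csInf_le ⟨0, by rintro _ ⟨γ, -, -, -, -, rfl⟩; exact curveLength_nonneg g γ⟩
    ⟨γ, hγ.1, hγ.2, h0, h1, rfl⟩

theorem le_dist (hU : Convex ℝ U) (hp : p ∈ U) (hq : q ∈ U) {c : ℝ}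
    (h : ∀ γ, IsCurveIn U γ → γ 0 = p → γ 1 = q → c ≤ curveLength g γ) : c ≤ dist g U p q := by
  refine le_csInf ⟨_, fun s : ℝ => AffineMap.lineMap p q s, ?_,
    fun s hs => hU.lineMap_mem hp hq hs, AffineMap.lineMap_apply_zero p q,
    AffineMap.lineMap_apply_one p q, rfl⟩ ?_
  · simp only [AffineMap.lineMap_apply_module']
    fun_prop
  · rintro _ ⟨γ, h₁, h₂, h₃, h₄, rfl⟩
    exact h γ ⟨h₁, h₂⟩ h₃ h₄

theorem dist_comm (hU : Convex ℝ U) (hneg : ∀ p X, g p (-X) (-X) = g p X X) (hp : p ∈ U)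
    (hq : q ∈ U) : dist g U p q = dist g U q p := by
  have key : ∀ {p q}, p ∈ U → q ∈ U → dist g U p q ≤ dist g U q p := fun {p q} hp hq => by
    refine le_dist hU hq hp fun γ hγ h0 h1 => ?_
    have hmaps : Set.MapsTo (fun s : ℝ => 1 - s) (Set.Icc 0 1) (Set.Icc 0 1) := fun s hs =>
      ⟨by linarith [hs.2], by linarith [hs.1]⟩
    have hrev : IsCurveIn U fun s => γ (1 - s) :=
      ⟨hγ.1.comp (by fun_prop) hmaps, fun s hs => hγ.2 _ (hmaps hs)⟩
    have hspeed : ∀ s ∈ Set.Icc (0 : ℝ) 1, speed g (fun s => γ (1 - s)) s = speed g γ (1 - s) :=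
      fun s hs => by
        have hd := (hγ.hasDerivWithinAt (hmaps hs)).scomp s
          ((hasDerivWithinAt_id s (Set.Icc 0 1)).const_sub 1) hmaps
        rw [speed, speed, show derivWithin (fun s => γ (1 - s)) (Set.Icc 0 1) s = _ from
          hd.derivWithin (uniqueDiffOn_Icc one_pos s hs), neg_one_smul, hneg]
    calc dist g U p q ≤ curveLength g fun s => γ (1 - s) :=
          dist_le_curveLength hrev (by simpa using h1) (by simpa using h0)
      _ = ∫ s in (0 : ℝ)..1, speed g γ (1 - s) :=
          intervalIntegral.integral_congr fun s hs =>
            hspeed s (by rwa [Set.uIcc_of_le zero_le_one] at hs)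
      _ = curveLength g γ := by
          rw [intervalIntegral.integral_comp_sub_left (speed g γ)]; simp [curveLength_eq]
  exact (key hp hq).antisymm (key hq hp)

section Maps

variable {E' : Type*} [NormedAddCommGroup E'] [NormedSpace ℝ E'] {g' : E' → E' → E' → ℝ}
  {U' : Set E'}

theorem dist_map_le (hU : Convex ℝ U)
    (hg : ContinuousOn (fun x : E × E => g x.1 x.2 x.2) (U ×ˢ Set.univ)) (L : E →L[ℝ] E')
    (hL : Set.MapsTo L U U') (hle : ∀ p ∈ U, ∀ X, g' (L p) (L X) (L X) ≤ g p X X)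
    (hp : p ∈ U) (hq : q ∈ U) : dist g' U' (L p) (L q) ≤ dist g U p q := by
  refine le_dist hU hp hq fun γ hγ h0 h1 => ?_
  have hspeed : ∀ s ∈ Set.Icc (0 : ℝ) 1, speed g' (fun s => L (γ s)) s ≤ speed g γ s :=
    fun s hs => by
      have hd := (L.hasFDerivAt.comp_hasDerivWithinAt s (hγ.hasDerivWithinAt hs)).derivWithin
        (uniqueDiffOn_Icc one_pos s hs)
      rw [speed, speed, show derivWithin (fun s => L (γ s)) (Set.Icc 0 1) s = _ from hd]
      exact Real.sqrt_le_sqrt (hle _ (hγ.2 s hs) _)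
  refine (dist_le_curveLength ⟨L.contDiff.comp_contDiffOn hγ.1, fun s hs => hL (hγ.2 s hs)⟩
    (congrArg L h0) (congrArg L h1)).trans ?_
  rw [curveLength_eq, curveLength_eq, intervalIntegral.integral_of_le zero_le_one,
    intervalIntegral.integral_of_le zero_le_one]
  refine MeasureTheory.integral_mono_of_nonneg (.of_forall fun s => speed_nonneg _ _ s)
    ((hγ.continuousOn_speed hg).integrableOn_Icc.mono_set Set.Ioc_subset_Icc_self)
    ((MeasureTheory.ae_restrict_iff' measurableSet_Ioc).2
      (.of_forall fun s hs => hspeed s (Set.Ioc_subset_Icc_self hs)))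

theorem dist_map_eq_of_retraction (hU : Convex ℝ U) (hU' : Convex ℝ U')
    (hg : ContinuousOn (fun x : E × E => g x.1 x.2 x.2) (U ×ˢ Set.univ))
    (hg' : ContinuousOn (fun x : E' × E' => g' x.1 x.2 x.2) (U' ×ˢ Set.univ))
    (f : E →L[ℝ] E') (π : E' →L[ℝ] E) (hf : Set.MapsTo f U U') (hπ : Set.MapsTo π U' U)
    (hπf : ∀ p, π (f p) = p) (hfle : ∀ p ∈ U, ∀ X, g' (f p) (f X) (f X) ≤ g p X X)
    (hπle : ∀ p ∈ U', ∀ X, g (π p) (π X) (π X) ≤ g' p X X) (hp : p ∈ U) (hq : q ∈ U) :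
    dist g' U' (f p) (f q) = dist g U p q := by
  have h := dist_map_le hU' hg' π hπ hπle (hf hp) (hf hq)
  rw [hπf, hπf] at h
  exact le_antisymm (dist_map_le hU hg f hf hfle hp hq) h

end Maps

theorem sub_le_dist (hU : Convex ℝ U)
    (hg : ContinuousOn (fun x : E × E => g x.1 x.2 x.2) (U ×ˢ Set.univ)) {f : E → ℝ}
    (hf : ∀ p ∈ U, DifferentiableAt ℝ f p) (hle : ∀ p ∈ U, ∀ X, |fderiv ℝ f p X| ≤ √(g p X X))
    (hp : p ∈ U) (hq : q ∈ U) : f p - f q ≤ dist g U p q := by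
  refine le_dist hU hp hq fun γ hγ h0 h1 => ?_
  have hcont : ContinuousOn (fun s => f (γ s)) (Set.Icc 0 1) := fun s hs =>
    (hf _ (hγ.2 s hs)).continuousAt.comp_continuousWithinAt (hγ.1.continuousOn s hs)
  have hderiv : ∀ s ∈ Set.Ioo (0 : ℝ) 1, HasDerivWithinAt (fun s => -f (γ s))
      (-fderiv ℝ f (γ s) (derivWithin γ (Set.Icc 0 1) s)) (Set.Ioi s) s := fun s hs => by
    have hs' := Set.Ioo_subset_Icc_self hs
    exact ((hf _ (hγ.2 s hs')).hasFDerivAt.comp_hasDerivAt s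
      ((hγ.hasDerivWithinAt hs').hasDerivAt (Icc_mem_nhds hs.1 hs.2))).neg.hasDerivWithinAt
  have h := intervalIntegral.sub_le_integral_of_hasDeriv_right_of_le zero_le_one hcont.neg hderiv
    (hγ.continuousOn_speed hg).integrableOn_Icc fun s hs =>
      (neg_le_abs _).trans (hle _ (hγ.2 s (Set.Ioo_subset_Icc_self hs)) _)
  simp only [Pi.neg_apply] at h
  rw [curveLength_eq, ← h0, ← h1]
  linarith

end Distance

end Riem

/-! ### The metric, its volume density and its Laplacian -/

theorem hasDerivAt_sqrt_one_div_pow (N : ℕ) {t : ℝ} (ht : 0 < t) :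
    HasDerivAt (fun s : ℝ => √((1 / s) ^ N)) (-(N / 2 : ℝ) / t * √((1 / t) ^ N)) t := by
  have heq : (fun s : ℝ => √((1 / s) ^ N)) =ᶠ[nhds t] fun s => s ^ (-(N / 2 : ℝ)) := by
    filter_upwards [lt_mem_nhds ht] with s hs
    rw [Real.sqrt_eq_rpow, one_div, ← Real.rpow_natCast, Real.inv_rpow hs.le,
      ← Real.rpow_neg hs.le, ← Real.rpow_mul hs.le]
    ring_nf
  rw [heq.eq_of_nhds]
  refine ((Real.hasDerivAt_rpow_const (Or.inl ht.ne')).congr_of_eventuallyEq heq).congr_deriv ?_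
  rw [Real.rpow_sub_one ht.ne']
  ring

namespace DamekRicci

section HalfSpace

variable {V Z : Type*}

theorem mem_halfSpace_one (x : V) (z : Z) : (x, z, (1 : ℝ)) ∈ halfSpace V Z :=
  show (0 : ℝ) < 1 from one_pos

variable [NormedAddCommGroup V] [NormedAddCommGroup Z]

theorem isOpen_halfSpace : IsOpen (halfSpace V Z) :=
  isOpen_lt continuous_const (continuous_snd.comp continuous_snd)

theorem convex_halfSpace [NormedSpace ℝ V] [NormedSpace ℝ Z] : Convex ℝ (halfSpace V Z) :=
  convex_halfSpace_gt (LinearMap.isLinear (LinearMap.snd ℝ Z ℝ ∘ₗ LinearMap.snd ℝ V (Z × ℝ))) 0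

end HalfSpace

/-- The rescaling of the standard inner product at height `t`: the metric at the point
`(0, 0, t)`. -/
def axisForm (V Z : Type*) [NormedAddCommGroup V] [InnerProductSpace ℝ V]
    [NormedAddCommGroup Z] [InnerProductSpace ℝ Z] (t : ℝ) : LinearMap.BilinForm ℝ (V × Z × ℝ) :=
  (1 / t) • (innerₗ V).compl₁₂ (LinearMap.fst ℝ V (Z × ℝ)) (LinearMap.fst ℝ V (Z × ℝ)) +
    (1 / t ^ 2) • (innerₗ (WithLp 2 (Z × ℝ))).compl₁₂
      ((WithLp.linearEquiv 2 ℝ (Z × ℝ)).symm ∘ₗ LinearMap.snd ℝ V (Z × ℝ))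
      ((WithLp.linearEquiv 2 ℝ (Z × ℝ)).symm ∘ₗ LinearMap.snd ℝ V (Z × ℝ))

theorem axisForm_apply {V Z : Type*} [NormedAddCommGroup V] [InnerProductSpace ℝ V]
    [NormedAddCommGroup Z] [InnerProductSpace ℝ Z] (t : ℝ) (X Y : V × Z × ℝ) :
    axisForm V Z t X Y =
      1 / t * ⟪X.1, Y.1⟫_ℝ + 1 / t ^ 2 * ⟪X.2.1, Y.2.1⟫_ℝ + X.2.2 * Y.2.2 / t ^ 2 := by
  simp [axisForm, WithLp.prod_inner_apply]
  ring

variable {V Z : Type*} [NormedAddCommGroup V] [InnerProductSpace ℝ V] [FiniteDimensional ℝ V]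
  [NormedAddCommGroup Z] [InnerProductSpace ℝ Z] [FiniteDimensional ℝ Z]

theorem coords_inl (i : Fin (Module.finrank ℝ V)) :
    coords V Z (Sum.inl i) = (stdOrthonormalBasis ℝ V i, 0, 0) := by
  simp [coords, Module.Basis.prod_apply, ← Prod.zero_eq_mk]

theorem coords_inr_inl (j : Fin (Module.finrank ℝ Z)) :
    coords V Z (Sum.inr (Sum.inl j)) = (0, stdOrthonormalBasis ℝ Z j, 0) := by
  simp [coords, Module.Basis.prod_apply]

theorem coords_inr_inr (u : Unit) : coords V Z (Sum.inr (Sum.inr u)) = (0, 0, 1) := by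
  simp [coords, Module.Basis.prod_apply]

theorem toMatrix_axisForm (t : ℝ) :
    LinearMap.BilinForm.toMatrix (coords V Z) (axisForm V Z t) =
      Matrix.diagonal (Sum.elim (fun _ => 1 / t) (fun _ => 1 / t ^ 2)) := by
  ext (i | i | i) (j | j | j) <;>
  simp [LinearMap.BilinForm.toMatrix_apply, axisForm_apply, coords_inl, coords_inr_inl,
    coords_inr_inr, Matrix.diagonal_apply, OrthonormalBasis.inner_eq_ite]

variable (D : DamekRicci V Z)

/-- The linear map `(v, z, t) ↦ (v, z + ½[v, v̄], t)` on the tangent space at `(v̄, z̄, t̄)`. -/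
def coframe (p : V × Z × ℝ) : V × Z × ℝ →ₗ[ℝ] V × Z × ℝ :=
  LinearMap.id + LinearMap.inr ℝ V (Z × ℝ) ∘ₗ LinearMap.inl ℝ Z ℝ ∘ₗ
    ((1 / 2 : ℝ) • (D.bracketL.flip p.1).toLinearMap) ∘ₗ LinearMap.fst ℝ V (Z × ℝ)

theorem coframe_apply (p X : V × Z × ℝ) :
    D.coframe p X = (X.1, X.2.1 + (1 / 2 : ℝ) • D.bracket X.1 p.1, X.2.2) := by
  simp [coframe, Prod.ext_iff]

theorem det_toMatrix_coframe (p : V × Z × ℝ) :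
    (LinearMap.toMatrix (coords V Z) (coords V Z) (D.coframe p)).det = 1 := by
  have h : LinearMap.toMatrix (coords V Z) (coords V Z) (D.coframe p) = Matrix.fromBlocks 1 0
      (Matrix.of fun k i => (coords V Z).repr (D.coframe p (coords V Z (Sum.inl i))) (Sum.inr k))
      1 := by
    ext (k | k | k) (i | i | i) <;>
    simp [LinearMap.toMatrix_apply, coframe_apply, coords, Module.Basis.prod_apply,
      Matrix.one_apply]
  rw [h, Matrix.det_fromBlocks_zero₁₂]
  simp

/-- The metric at `p` as a bilinear form. -/
def metricForm (p : V × Z × ℝ) : LinearMap.BilinForm ℝ (V × Z × ℝ) :=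
  (axisForm V Z p.2.2).compl₁₂ (D.coframe p) (D.coframe p)

theorem metricForm_apply (p X Y : V × Z × ℝ) : D.metricForm p X Y = D.metric p X Y := by
  simp only [metricForm, LinearMap.compl₁₂_apply, axisForm_apply, coframe_apply, metric]

theorem det_gram (p : V × Z × ℝ) :
    (Riem.gram D.metric (coords V Z) p).det =
      (1 / p.2.2) ^ (Module.finrank ℝ V + 2 * Module.finrank ℝ Z + 2) := by
  rw [Riem.gram_eq_toMatrix (D.metricForm_apply p),
    show D.metricForm p = (axisForm V Z p.2.2).comp (D.coframe p) (D.coframe p) from rfl,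
    LinearMap.BilinForm.toMatrix_comp (coords V Z) (coords V Z), toMatrix_axisForm, Matrix.det_mul,
    Matrix.det_mul, Matrix.det_transpose, det_toMatrix_coframe, Matrix.det_diagonal]
  simp [Fintype.prod_sum_type, pow_add, pow_mul]
  ring

theorem metric_comm (p X Y : V × Z × ℝ) : D.metric p X Y = D.metric p Y X := by
  simp only [metric, mul_comm Y.2.2]
  rw [real_inner_comm, real_inner_comm (_ + _)]

theorem metric_neg_neg (p X : V × Z × ℝ) : D.metric p (-X) (-X) = D.metric p X X := by
  simp [← metricForm_apply]

theorem metric_self_nonneg {p : V × Z × ℝ} (hp : p ∈ halfSpace V Z) (X : V × Z × ℝ) :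
    0 ≤ D.metric p X X := by
  have hp' : 0 < p.2.2 := hp
  simp only [metric, real_inner_self_eq_norm_sq, ← sq]
  positivity

theorem abs_metric_le {p : V × Z × ℝ} (hp : p ∈ halfSpace V Z) (X Y : V × Z × ℝ) :
    |D.metric p X Y| ≤ √(D.metric p X X) * √(D.metric p Y Y) := by
  rw [← Real.sqrt_mul (D.metric_self_nonneg hp X)]
  simp only [← metricForm_apply]
  exact Real.abs_le_sqrt ((D.metricForm p).apply_sq_le_of_symm
    (fun X => by rw [metricForm_apply]; exact D.metric_self_nonneg hp X)
    ⟨fun X Y => by simp only [metricForm_apply]; exact D.metric_comm p X Y⟩ X Y)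

theorem continuousOn_metric :
    ContinuousOn (fun x : (V × Z × ℝ) × (V × Z × ℝ) => D.metric x.1 x.2 x.2)
      (halfSpace V Z ×ˢ Set.univ) := by
  have h : ∀ x ∈ halfSpace V Z ×ˢ (Set.univ : Set (V × Z × ℝ)), x.1.2.2 ≠ 0 :=
    fun x hx => (show 0 < x.1.2.2 from hx.1).ne'
  have h' : ∀ x ∈ halfSpace V Z ×ˢ (Set.univ : Set (V × Z × ℝ)), x.1.2.2 ^ 2 ≠ 0 :=
    fun x hx => pow_ne_zero 2 (h x hx)
  simp only [metric, ← bracketL_apply]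
  fun_prop (disch := assumption)

theorem gradient_eq {F : V × Z × ℝ → ℝ} {p : V × Z × ℝ} (hp : p ∈ halfSpace V Z)
    {G : V × Z × ℝ} (hG : ∀ X, D.metric p G X = fderiv ℝ F p X) :
    Riem.gradient D.metric (coords V Z) F p = G := by
  have hp' : 0 < p.2.2 := hp
  refine Riem.gradient_eq (D.metricForm_apply p) (fun X Y => ?_) ?_ hG
  · simpa only [metricForm_apply] using D.metric_comm p X Y
  · rw [det_gram]
    positivity

theorem volDensity_eq (p : V × Z × ℝ) :
    Riem.volDensity D.metric (coords V Z) p =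
      √((1 / p.2.2) ^ (Module.finrank ℝ V + 2 * Module.finrank ℝ Z + 2)) := by
  rw [Riem.volDensity, det_gram]

theorem hasFDerivAt_volDensity {p : V × Z × ℝ} (hp : p ∈ halfSpace V Z) :
    HasFDerivAt (Riem.volDensity D.metric (coords V Z))
      ((-((Module.finrank ℝ V + 2 * Module.finrank ℝ Z + 2) / 2) / p.2.2 *
        Riem.volDensity D.metric (coords V Z) p) •
          (ContinuousLinearMap.snd ℝ Z ℝ ∘L ContinuousLinearMap.snd ℝ V (Z × ℝ))) p := by
  have h := (hasDerivAt_sqrt_one_div_pow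
    (Module.finrank ℝ V + 2 * Module.finrank ℝ Z + 2) hp).comp_hasFDerivAt p
      (ContinuousLinearMap.snd ℝ Z ℝ ∘L ContinuousLinearMap.snd ℝ V (Z × ℝ)).hasFDerivAt
  rw [funext D.volDensity_eq]
  exact_mod_cast h

theorem laplacian_eq_trace {F : V × Z × ℝ → ℝ} {G : V × Z × ℝ → V × Z × ℝ} {p : V × Z × ℝ}
    (hp : p ∈ halfSpace V Z)
    (hG : ∀ q ∈ halfSpace V Z, Riem.gradient D.metric (coords V Z) F q = G q)
    (hGd : DifferentiableAt ℝ G p) :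
    Riem.laplacian D.metric (coords V Z) F p = LinearMap.trace ℝ (V × Z × ℝ) (fderiv ℝ G p) -
      (Module.finrank ℝ V + 2 * Module.finrank ℝ Z + 2) / 2 / p.2.2 * (G p).2.2 := by
  have hp' : 0 < p.2.2 := hp
  have hv : Riem.volDensity D.metric (coords V Z) p ≠ 0 := by
    rw [volDensity_eq]
    positivity
  have hd := D.hasFDerivAt_volDensity hp
  rw [Riem.laplacian_eq_trace
    (Filter.eventually_of_mem (isOpen_halfSpace.mem_nhds hp) hG) hGd hd.differentiableAt hv,
    hd.fderiv]
  simp only [_root_.smul_apply, ContinuousLinearMap.comp_apply,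
    ContinuousLinearMap.coe_snd', smul_eq_mul]
  field_simp
  ring

end DamekRicci

namespace DamekRicci

/-! ### The function `F` and its gradient -/

section

variable {V Z : Type*} [NormedAddCommGroup V] [InnerProductSpace ℝ V] [FiniteDimensional ℝ V]
  [NormedAddCommGroup Z] [InnerProductSpace ℝ Z] (W : Submodule ℝ V)

/-- The term `t + ½‖Π₂ v‖²` of `F`, for `𝔳₁ = W` and `𝔳₂ = Wᗮ`. -/
def quarticA (p : V × Z × ℝ) : ℝ := p.2.2 + 1 / 2 * ‖Wᗮ.starProjection p.1‖ ^ 2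

theorem norm_starProjection_orthogonal_sq {V Z : Type*} [NormedAddCommGroup V]
    [InnerProductSpace ℝ V] [FiniteDimensional ℝ V] (W : Submodule ℝ V) (p : V × Z × ℝ) :
    ‖Wᗮ.starProjection p.1‖ ^ 2 = 2 * (quarticA W p - p.2.2) := by
  rw [quarticA]
  ring

theorem contDiff_quarticA {n : WithTop ℕ∞} : ContDiff ℝ n (quarticA W : V × Z × ℝ → ℝ) := by
  have h : ContDiff ℝ n fun p : V × Z × ℝ => Wᗮ.starProjection p.1 := by fun_prop
  exact contDiff_snd.snd.add (contDiff_const.mul (h.norm_sq ℝ))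

theorem fderiv_quarticA (p X : V × Z × ℝ) :
    fderiv ℝ (quarticA W) p X = X.2.2 + ⟪Wᗮ.starProjection p.1, Wᗮ.starProjection X.1⟫_ℝ := by
  have hpr : HasFDerivAt (fun q : V × Z × ℝ => Wᗮ.starProjection q.1) _ p :=
    (Wᗮ.starProjection ∘L ContinuousLinearMap.fst ℝ V (Z × ℝ)).hasFDerivAt
  have h : HasFDerivAt (quarticA W) _ p :=
    hasFDerivAt_snd.snd.add (hpr.norm_sq.const_mul (1 / 2 : ℝ))
  rw [h.fderiv]
  simp [-Submodule.starProjection_orthogonal_val]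

end

variable {V Z : Type*} [NormedAddCommGroup V] [InnerProductSpace ℝ V] [FiniteDimensional ℝ V]
  [NormedAddCommGroup Z] [InnerProductSpace ℝ Z] [FiniteDimensional ℝ Z]

section Gradient

variable (D : DamekRicci V Z) (W : Submodule ℝ V)

/-- The term `z - ½[Π₁ v, Π₂ v]` of `F`, for `𝔳₁ = W` and `𝔳₂ = Wᗮ`. -/
def quarticB (p : V × Z × ℝ) : Z :=
  p.2.1 - (1 / 2 : ℝ) • D.bracket (W.starProjection p.1) (Wᗮ.starProjection p.1)

theorem quarticF_eq (p : V × Z × ℝ) :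
    D.quarticF W Wᗮ p = (quarticA W p ^ 2 + ‖D.quarticB W p‖ ^ 2) / p.2.2 ^ 2 := rfl

theorem one_le_quarticF {p : V × Z × ℝ} (hp : p ∈ halfSpace V Z) : 1 ≤ D.quarticF W Wᗮ p := by
  have hp' : 0 < p.2.2 := hp
  have hA : p.2.2 ≤ quarticA W p := le_add_of_nonneg_right (by positivity)
  rw [quarticF_eq, one_le_div (by positivity)]
  exact le_add_of_le_of_nonneg (pow_le_pow_left₀ hp'.le hA 2) (sq_nonneg _)

theorem contDiff_quarticB {n : WithTop ℕ∞} : ContDiff ℝ n (D.quarticB W) := by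
  unfold quarticB
  simp only [← bracketL_apply]
  fun_prop

theorem contDiffOn_quarticF {n : WithTop ℕ∞} :
    ContDiffOn ℝ n (D.quarticF W Wᗮ) (halfSpace V Z) :=
  (((contDiff_quarticA W).pow 2).add ((D.contDiff_quarticB W).norm_sq ℝ)).contDiffOn.div
    (contDiff_snd.snd.pow 2).contDiffOn fun _ hp => pow_ne_zero 2 (ne_of_gt hp)

theorem differentiableAt_quarticF {p : V × Z × ℝ} (hp : p ∈ halfSpace V Z) :
    DifferentiableAt ℝ (D.quarticF W Wᗮ) p :=
  (D.contDiffOn_quarticF W (n := 1)).differentiableOn one_ne_zero |>.differentiableAt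
    (isOpen_halfSpace.mem_nhds hp)

theorem fderiv_quarticB (p X : V × Z × ℝ) :
    fderiv ℝ (D.quarticB W) p X = X.2.1 - (1 / 2 : ℝ) •
      (D.bracket (W.starProjection X.1) (Wᗮ.starProjection p.1) +
        D.bracket (W.starProjection p.1) (Wᗮ.starProjection X.1)) := by
  have hpr : ∀ U : Submodule ℝ V, HasFDerivAt (fun q : V × Z × ℝ => U.starProjection q.1)
      (U.starProjection ∘L ContinuousLinearMap.fst ℝ V (Z × ℝ)) p := fun U =>
    (U.starProjection ∘L ContinuousLinearMap.fst ℝ V (Z × ℝ)).hasFDerivAt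
  have h : HasFDerivAt (D.quarticB W) _ p := hasFDerivAt_snd.fst.sub
    ((D.bracketL.hasFDerivAt_of_bilinear (hpr W) (hpr Wᗮ)).const_smul (1 / 2 : ℝ))
  rw [h.fderiv]
  simp [-Submodule.starProjection_orthogonal_val, add_comm]

theorem fderiv_quarticF {p : V × Z × ℝ} (hp : p ∈ halfSpace V Z) (X : V × Z × ℝ) :
    fderiv ℝ (D.quarticF W Wᗮ) p X =
      (2 * quarticA W p * fderiv ℝ (quarticA W) p X +
        2 * ⟪D.quarticB W p, fderiv ℝ (D.quarticB W) p X⟫_ℝ) / p.2.2 ^ 2 -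
        2 * D.quarticF W Wᗮ p / p.2.2 * X.2.2 := by
  have hp' : p.2.2 ≠ 0 := ne_of_gt hp
  have hA := ((contDiff_quarticA W).differentiable one_ne_zero p).hasFDerivAt
  have hB := ((D.contDiff_quarticB W).differentiable one_ne_zero p).hasFDerivAt
  have ht : HasFDerivAt (fun q : V × Z × ℝ => q.2.2) _ p :=
    (ContinuousLinearMap.snd ℝ Z ℝ ∘L ContinuousLinearMap.snd ℝ V (Z × ℝ)).hasFDerivAt
  have h : HasFDerivAt (D.quarticF W Wᗮ) _ p := ((hA.pow 2).add hB.norm_sq).mul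
    ((hasDerivAt_inv (pow_ne_zero 2 hp')).comp_hasFDerivAt p (ht.pow 2))
  rw [h.fderiv, quarticF_eq]
  simp
  field_simp
  ring

/-- The component in `V` of the gradient of `F`. -/
def gradFst (p : V × Z × ℝ) : V :=
  p.2.2⁻¹ • ((2 * quarticA W p) • Wᗮ.starProjection p.1 +
    Wᗮ.starProjection (D.J (D.quarticB W p) (Wᗮ.starProjection p.1)) +
    W.starProjection (D.J (D.quarticB W p)
      (W.starProjection p.1 + (2 : ℝ) • Wᗮ.starProjection p.1)))

/-- The gradient of `F`. -/
def gradF (p : V × Z × ℝ) : V × Z × ℝ :=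
  (D.gradFst W p, (2 : ℝ) • D.quarticB W p - (1 / 2 : ℝ) • D.bracket (D.gradFst W p) p.1,
    2 * quarticA W p - 2 * D.quarticF W Wᗮ p * p.2.2)

theorem metric_gradF {p : V × Z × ℝ} (hp : p ∈ halfSpace V Z) (X : V × Z × ℝ) :
    D.metric p (D.gradF W p) X = fderiv ℝ (D.quarticF W Wᗮ) p X := by
  have hp' : p.2.2 ≠ 0 := ne_of_gt hp
  rw [fderiv_quarticF _ _ hp, fderiv_quarticA, fderiv_quarticB]
  simp only [metric, gradF, sub_add_cancel, gradFst, real_inner_smul_left, inner_add_left,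
    Submodule.inner_starProjection_left_eq_right]
  set x := W.starProjection p.1
  set y := Wᗮ.starProjection p.1
  set x' := W.starProjection X.1
  set y' := Wᗮ.starProjection X.1
  have hv : x + y = p.1 := W.starProjection_add_starProjection_orthogonal p.1
  have hX : x' + y' = X.1 := W.starProjection_add_starProjection_orthogonal X.1
  have hy' : Wᗮ.starProjection y' = y' :=
    Wᗮ.starProjection_eq_self_iff.2 (Wᗮ.starProjection_apply_mem X.1)
  have hbr : ⟪D.quarticB W p, D.bracket X.1 p.1⟫_ℝ = ⟪D.J (D.quarticB W p) (x' + y'), x + y⟫_ℝ := by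
    rw [inner_bracket_right, hX, hv]
  have hc : ∀ a b : V, ⟪D.J (D.quarticB W p) a, b⟫_ℝ = -⟪D.J (D.quarticB W p) b, a⟫_ℝ :=
    fun a b => by rw [inner_J_left, real_inner_comm]
  simp only [inner_add_right, inner_sub_right, real_inner_smul_right, hbr, hy',
    inner_bracket_right, map_add, map_smul, inner_add_left, real_inner_smul_left]
  rw [hc x y', hc y y', hc x x', hc y x']
  field_simp
  ring

theorem gradient_quarticF {p : V × Z × ℝ} (hp : p ∈ halfSpace V Z) :
    Riem.gradient D.metric (coords V Z) (D.quarticF W Wᗮ) p = D.gradF W p :=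
  D.gradient_eq hp (D.metric_gradF W hp)

/-- The obstruction to the eikonal equation `‖∇F‖² = 4F(F - 1)`, see `gradNormSq_quarticF`. -/
def eikonalDefect (p : V × Z × ℝ) : ℝ :=
  ‖Wᗮ.starProjection (D.J (D.quarticB W p) (Wᗮ.starProjection p.1))‖ ^ 2 +
    ‖W.starProjection (D.J (D.quarticB W p)
      (W.starProjection p.1 + (2 : ℝ) • Wᗮ.starProjection p.1))‖ ^ 2 -
    4 * ‖D.quarticB W p‖ ^ 2 * ‖Wᗮ.starProjection p.1‖ ^ 2

theorem norm_gradFst_sq (p : V × Z × ℝ) :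
    ‖D.gradFst W p‖ ^ 2 = p.2.2⁻¹ ^ 2 *
      (4 * (quarticA W p ^ 2 + ‖D.quarticB W p‖ ^ 2) * ‖Wᗮ.starProjection p.1‖ ^ 2 +
        D.eikonalDefect W p) := by
  rw [eikonalDefect, gradFst]
  set y := Wᗮ.starProjection p.1
  set a := Wᗮ.starProjection (D.J (D.quarticB W p) y)
  set b := W.starProjection (D.J (D.quarticB W p) (W.starProjection p.1 + (2 : ℝ) • y))
  have hy : y ∈ Wᗮ := Wᗮ.starProjection_apply_mem p.1
  have hb : b ∈ W := W.starProjection_apply_mem _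
  have hya : ⟪y, a⟫_ℝ = 0 := by
    rw [← Submodule.inner_starProjection_left_eq_right, Wᗮ.starProjection_eq_self_iff.2 hy,
      real_inner_comm, inner_J_self]
  have hyb : ⟪y, b⟫_ℝ = 0 := Submodule.inner_left_of_mem_orthogonal hb hy
  have hab : ⟪a, b⟫_ℝ = 0 :=
    Submodule.inner_left_of_mem_orthogonal hb (Wᗮ.starProjection_apply_mem _)
  rw [norm_smul, mul_pow, norm_add_sq_real, norm_add_sq_real, norm_smul, inner_add_left,
    real_inner_smul_left, real_inner_smul_left, hya, hyb, hab, Real.norm_eq_abs, Real.norm_eq_abs,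
    sq_abs, mul_pow, sq_abs]
  ring

theorem gradNormSq_quarticF {p : V × Z × ℝ} (hp : p ∈ halfSpace V Z) :
    Riem.gradNormSq D.metric (coords V Z) (D.quarticF W Wᗮ) p =
      4 * D.quarticF W Wᗮ p * (D.quarticF W Wᗮ p - 1) + D.eikonalDefect W p / p.2.2 ^ 3 := by
  have hp' : p.2.2 ≠ 0 := ne_of_gt hp
  rw [Riem.gradNormSq, gradient_quarticF D W hp, metric]
  simp only [gradF, sub_add_cancel, real_inner_self_eq_norm_sq, norm_smul, Real.norm_two, mul_pow,
    norm_gradFst_sq, norm_starProjection_orthogonal_sq, quarticF_eq]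
  field_simp
  ring

end Gradient

/-! ### Transnormality -/

section Transnormal

variable {D : DamekRicci V Z} {W : Submodule ℝ V}

theorem Swaps.eikonalDefect_eq_zero (hJ : D.Swaps W) (p : V × Z × ℝ) :
    D.eikonalDefect W p = 0 := by
  have hx := W.starProjection_apply_mem p.1
  have hy := Wᗮ.starProjection_apply_mem p.1
  rw [eikonalDefect, map_add, map_add, map_smul, map_smul,
    W.starProjection_apply_eq_zero_iff.2 (hJ.1 _ _ hx), hJ.starProjection_J _ hy,
    hJ.starProjection_orthogonal_J _ hy, zero_add, norm_smul, norm_J, norm_zero, Real.norm_two]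
  ring

theorem Swaps.isTransnormal (hJ : D.Swaps W) : D.IsTransnormal (D.quarticF W Wᗮ) := by
  refine ⟨D.contDiffOn_quarticF W, fun c => 4 * c * (c - 1), by fun_prop, fun p hp => ?_⟩
  rw [D.gradNormSq_quarticF W hp, hJ.eikonalDefect_eq_zero, zero_div, add_zero]

theorem quarticB_of_mem {x : V} (hx : x ∈ W) (z : Z) (t : ℝ) : D.quarticB W (x, z, t) = z := by
  simp [quarticB, W.starProjection_eq_self_iff.2 hx]

theorem quarticB_of_mem_orthogonal {y : V} (hy : y ∈ Wᗮ) (z : Z) (t : ℝ) :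
    D.quarticB W (y, z, t) = z := by
  simp [quarticB, W.starProjection_apply_eq_zero_iff.2 hy]

theorem exists_quarticF_eq [Nontrivial Z] {c : ℝ} (hc : 1 ≤ c) :
    ∃ w : Z, D.quarticF W Wᗮ (0, w, 1) = c := by
  obtain ⟨w, hw⟩ := exists_norm_eq Z (Real.sqrt_nonneg (c - 1))
  exact ⟨w, by simp [quarticF_eq, quarticA, quarticB, hw, Real.sq_sqrt (sub_nonneg.2 hc)]⟩

theorem eikonalDefect_eq_zero_of_isTransnormal [Nontrivial Z]
    (h : D.IsTransnormal (D.quarticF W Wᗮ)) {p : V × Z × ℝ} (hp : p ∈ halfSpace V Z) :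
    D.eikonalDefect W p = 0 := by
  obtain ⟨-, β, -, hβ⟩ := h
  obtain ⟨w, hw⟩ := exists_quarticF_eq (D := D) (W := W) (D.one_le_quarticF W hp)
  have hp' : p.2.2 ≠ 0 := ne_of_gt hp
  have hw' : D.eikonalDefect W (0, w, 1) = 0 := by simp [eikonalDefect]
  have h := (hβ p hp).trans ((congrArg β hw).symm.trans (hβ _ (mem_halfSpace_one 0 w)).symm)
  rw [gradNormSq_quarticF _ _ hp, gradNormSq_quarticF _ _ (mem_halfSpace_one 0 w), hw, hw',
    zero_div, add_right_inj] at h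
  simpa [hp'] using h

theorem swaps_of_isTransnormal (h : D.IsTransnormal (D.quarticF W Wᗮ)) : D.Swaps W := by
  rcases subsingleton_or_nontrivial Z with _ | _
  · exact ⟨fun z v _ => by simp [Subsingleton.elim z 0],
      fun z v _ => by simp [Subsingleton.elim z 0]⟩
  refine ⟨fun z x hx => ?_, fun z y hy => ?_⟩
  · have hd := eikonalDefect_eq_zero_of_isTransnormal h (mem_halfSpace_one x z)
    rw [eikonalDefect, quarticB_of_mem hx, W.starProjection_eq_self_iff.2 hx,
      Submodule.starProjection_orthogonal_apply_eq_zero hx] at hd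
    exact W.starProjection_apply_eq_zero_iff.1 (by simpa using hd)
  · have hd := eikonalDefect_eq_zero_of_isTransnormal h (mem_halfSpace_one y z)
    have hpyth := W.norm_sq_eq_add_norm_sq_starProjection (D.J z y)
    rw [eikonalDefect, quarticB_of_mem_orthogonal hy, Wᗮ.starProjection_eq_self_iff.2 hy,
      W.starProjection_apply_eq_zero_iff.2 hy, zero_add, map_smul, map_smul, norm_smul,
      Real.norm_two] at hd
    rw [norm_J] at hpyth
    have h0 : ‖Wᗮ.starProjection (D.J z y)‖ ^ 2 = 0 := by linarith
    rw [← W.orthogonal_orthogonal]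
    exact Wᗮ.starProjection_apply_eq_zero_iff.1
      (norm_eq_zero.1 ((pow_eq_zero_iff two_ne_zero).1 h0))

theorem isTransnormal_quarticF_iff : D.IsTransnormal (D.quarticF W Wᗮ) ↔ D.Swaps W :=
  ⟨swaps_of_isTransnormal, Swaps.isTransnormal⟩

end Transnormal

end DamekRicci

namespace DamekRicci

/-! ### The Laplacian of `F` -/

variable {V Z : Type*} [NormedAddCommGroup V] [InnerProductSpace ℝ V] [FiniteDimensional ℝ V]
  [NormedAddCommGroup Z] [InnerProductSpace ℝ Z] [FiniteDimensional ℝ Z]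
  {D : DamekRicci V Z} {W : Submodule ℝ V}

namespace Swaps

variable (hJ : D.Swaps W)
include hJ

theorem gradFst_eq (p : V × Z × ℝ) :
    D.gradFst W p = (2 * p.2.2⁻¹) • (quarticA W p • Wᗮ.starProjection p.1 +
      D.J (D.quarticB W p) (Wᗮ.starProjection p.1)) := by
  have hy := Wᗮ.starProjection_apply_mem p.1
  rw [gradFst, map_add, map_add, map_smul, map_smul, hJ.starProjection_orthogonal_J _ hy,
    W.starProjection_apply_eq_zero_iff.2 (hJ.1 _ _ (W.starProjection_apply_mem p.1)),
    hJ.starProjection_J _ hy]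
  module

theorem hasFDerivAt_gradFst {p : V × Z × ℝ} (hp : p ∈ halfSpace V Z) :
    ∃ L : V × Z × ℝ →L[ℝ] V, HasFDerivAt (D.gradFst W) L p ∧ ∀ X, L X =
      (2 * p.2.2⁻¹) • (fderiv ℝ (quarticA W) p X • Wᗮ.starProjection p.1 +
        quarticA W p • Wᗮ.starProjection X.1 +
        D.J (fderiv ℝ (D.quarticB W) p X) (Wᗮ.starProjection p.1) +
        D.J (D.quarticB W p) (Wᗮ.starProjection X.1)) - (X.2.2 * p.2.2⁻¹) • D.gradFst W p := by
  have hp' : p.2.2 ≠ 0 := ne_of_gt hp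
  have hA := ((contDiff_quarticA W).differentiable one_ne_zero p).hasFDerivAt
  have hB := ((D.contDiff_quarticB W).differentiable one_ne_zero p).hasFDerivAt
  have ht : HasFDerivAt (fun q : V × Z × ℝ => q.2.2) _ p :=
    (ContinuousLinearMap.snd ℝ Z ℝ ∘L ContinuousLinearMap.snd ℝ V (Z × ℝ)).hasFDerivAt
  have hy : HasFDerivAt (fun q : V × Z × ℝ => Wᗮ.starProjection q.1) _ p :=
    (Wᗮ.starProjection ∘L ContinuousLinearMap.fst ℝ V (Z × ℝ)).hasFDerivAt
  have h : HasFDerivAt (D.gradFst W) _ p :=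
    ((((hasDerivAt_inv hp').comp_hasFDerivAt p ht).const_mul 2).smul
      ((hA.smul hy).add (D.JL.hasFDerivAt_of_bilinear hB hy))).congr_of_eventuallyEq
      (.of_forall hJ.gradFst_eq)
  refine ⟨_, h, fun X => ?_⟩
  simp [-Submodule.starProjection_orthogonal_val, hJ.gradFst_eq]
  module

theorem differentiableAt_gradFst {p : V × Z × ℝ} (hp : p ∈ halfSpace V Z) :
    DifferentiableAt ℝ (D.gradFst W) p :=
  let ⟨_, hL, _⟩ := hJ.hasFDerivAt_gradFst hp
  hL.differentiableAt

theorem fderiv_gradFst {p : V × Z × ℝ} (hp : p ∈ halfSpace V Z) (X : V × Z × ℝ) :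
    fderiv ℝ (D.gradFst W) p X =
      (2 * p.2.2⁻¹) • (fderiv ℝ (quarticA W) p X • Wᗮ.starProjection p.1 +
        quarticA W p • Wᗮ.starProjection X.1 +
        D.J (fderiv ℝ (D.quarticB W) p X) (Wᗮ.starProjection p.1) +
        D.J (D.quarticB W p) (Wᗮ.starProjection X.1)) - (X.2.2 * p.2.2⁻¹) • D.gradFst W p :=
  let ⟨_, hL, h⟩ := hJ.hasFDerivAt_gradFst hp
  hL.fderiv ▸ h X

theorem hasFDerivAt_gradF {p : V × Z × ℝ} (hp : p ∈ halfSpace V Z) :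
    HasFDerivAt (D.gradF W) ((fderiv ℝ (D.gradFst W) p).prod
      (((2 : ℝ) • fderiv ℝ (D.quarticB W) p - (1 / 2 : ℝ) •
        (D.bracketL.precompR _ (D.gradFst W p) (ContinuousLinearMap.fst ℝ V (Z × ℝ)) +
          D.bracketL.precompL _ (fderiv ℝ (D.gradFst W) p) p.1)).prod
      ((2 : ℝ) • fderiv ℝ (quarticA W) p - ((2 * D.quarticF W Wᗮ p) •
        (ContinuousLinearMap.snd ℝ Z ℝ ∘L ContinuousLinearMap.snd ℝ V (Z × ℝ)) +
          p.2.2 • (2 : ℝ) • fderiv ℝ (D.quarticF W Wᗮ) p)))) p := by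
  have hA := ((contDiff_quarticA W).differentiable one_ne_zero p).hasFDerivAt
  have hB := ((D.contDiff_quarticB W).differentiable one_ne_zero p).hasFDerivAt
  have hF := (D.differentiableAt_quarticF W hp).hasFDerivAt
  have hV := (hJ.differentiableAt_gradFst hp).hasFDerivAt
  have hv : HasFDerivAt (fun q : V × Z × ℝ => q.1) _ p :=
    (ContinuousLinearMap.fst ℝ V (Z × ℝ)).hasFDerivAt
  have ht : HasFDerivAt (fun q : V × Z × ℝ => q.2.2) _ p :=
    (ContinuousLinearMap.snd ℝ Z ℝ ∘L ContinuousLinearMap.snd ℝ V (Z × ℝ)).hasFDerivAt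
  exact hV.prodMk (((hB.const_smul (2 : ℝ)).sub
    ((D.bracketL.hasFDerivAt_of_bilinear hV hv).const_smul (1 / 2 : ℝ))).prodMk
    ((hA.const_mul 2).sub ((hF.const_mul 2).mul ht)))

theorem fderiv_gradFst_inl {p : V × Z × ℝ} (hp : p ∈ halfSpace V Z) (u : V) :
    fderiv ℝ (D.gradFst W) p (u, 0) =
      (2 * p.2.2⁻¹) • (⟪Wᗮ.starProjection p.1, u⟫_ℝ • Wᗮ.starProjection p.1 +
        quarticA W p • Wᗮ.starProjection u +
        (1 / 2 : ℝ) • D.J (D.bracket (Wᗮ.starProjection p.1 - W.starProjection p.1) u)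
          (Wᗮ.starProjection p.1) +
        D.J (D.quarticB W p) (Wᗮ.starProjection u)) := by
  rw [hJ.fderiv_gradFst hp, fderiv_quarticA, fderiv_quarticB]
  have hx := W.starProjection_apply_mem p.1
  have hy := Wᗮ.starProjection_apply_mem p.1
  set x := W.starProjection p.1
  set y := Wᗮ.starProjection p.1
  have hu := W.starProjection_add_starProjection_orthogonal u
  have hyu : D.bracket y u = D.bracket y (W.starProjection u) := by
    conv_lhs => rw [← hu, bracket_add_right,
      hJ.bracket_orthogonal_eq_zero hy (Wᗮ.starProjection_apply_mem u), add_zero]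
  have hxu : D.bracket x u = D.bracket x (Wᗮ.starProjection u) := by
    conv_lhs => rw [← hu, bracket_add_right,
      hJ.bracket_eq_zero hx (W.starProjection_apply_mem u), zero_add]
  have hyu' : ⟪y, Wᗮ.starProjection u⟫_ℝ = ⟪y, u⟫_ℝ := by
    rw [← Submodule.inner_starProjection_left_eq_right, Wᗮ.starProjection_eq_self_iff.2 hy]
  rw [bracket_sub_left, hyu, hxu, hyu', D.bracket_swap (W.starProjection u) y]
  simp only [Prod.fst_zero, Prod.snd_zero, map_sub, map_smul, map_add, map_neg, map_zero,
    LinearMap.sub_apply, LinearMap.smul_apply, LinearMap.add_apply, LinearMap.neg_apply,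
    LinearMap.zero_apply]
  module

theorem trace_fderiv_gradFst {p : V × Z × ℝ} (hp : p ∈ halfSpace V Z) :
    LinearMap.trace ℝ V (fderiv ℝ (D.gradFst W) p ∘ₗ LinearMap.inl ℝ V (Z × ℝ)) =
      p.2.2⁻¹ * ((2 + Module.finrank ℝ Z) * ‖Wᗮ.starProjection p.1‖ ^ 2 +
        2 * quarticA W p * Module.finrank ℝ Wᗮ) := by
  set x := W.starProjection p.1
  set y := Wᗮ.starProjection p.1
  have h : (fderiv ℝ (D.gradFst W) p ∘ₗ LinearMap.inl ℝ V (Z × ℝ) : V →ₗ[ℝ] V) =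
      (2 * p.2.2⁻¹) • ((InnerProductSpace.rankOne ℝ y y).toLinearMap +
        quarticA W p • Wᗮ.starProjection.toLinearMap +
        (1 / 2 : ℝ) • (D.J.flip y ∘ₗ (D.bracketL (y - x)).toLinearMap) +
        D.J (D.quarticB W p) ∘ₗ Wᗮ.starProjection) :=
    LinearMap.ext fun u => hJ.fderiv_gradFst_inl hp u
  have hxy : ⟪x, y⟫_ℝ = 0 := Submodule.inner_right_of_mem_orthogonal
    (W.starProjection_apply_mem p.1) (Wᗮ.starProjection_apply_mem p.1)
  rw [h]
  simp only [map_smul, map_add, InnerProductSpace.trace_rankOne, trace_starProjection,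
    LinearMap.trace_comp_comm' (D.bracketL (y - x)).toLinearMap, trace_bracket_comp_J,
    hJ.trace_J_comp_starProjection, inner_sub_left, hxy, real_inner_self_eq_norm_sq, smul_eq_mul]
  ring

theorem trace_fderiv_gradF {p : V × Z × ℝ} (hp : p ∈ halfSpace V Z) :
    LinearMap.trace ℝ (V × Z × ℝ) (fderiv ℝ (D.gradF W) p) =
      p.2.2⁻¹ * ((2 + Module.finrank ℝ Z) * ‖Wᗮ.starProjection p.1‖ ^ 2 +
        2 * quarticA W p * Module.finrank ℝ Wᗮ) +
      (Module.finrank ℝ Z * (2 + p.2.2⁻¹ * ‖Wᗮ.starProjection p.1‖ ^ 2) +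
        (2 + 2 * D.quarticF W Wᗮ p - 4 * quarticA W p * p.2.2⁻¹)) := by
  have hp' : p.2.2 ≠ 0 := ne_of_gt hp
  rw [(hJ.hasFDerivAt_gradF hp).fderiv, trace_prod_eq_add, trace_prod_eq_add]
  congr 1
  · exact hJ.trace_fderiv_gradFst hp
  congr 1
  · refine (congrArg (LinearMap.trace ℝ Z) (?_ : _ = (2 : ℝ) • LinearMap.id + p.2.2⁻¹ •
      ((D.bracketL p.1).toLinearMap ∘ₗ D.J.flip (Wᗮ.starProjection p.1)))).trans ?_
    · refine LinearMap.ext fun w => ?_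
      simp [-Submodule.starProjection_orthogonal_val, hJ.fderiv_gradFst hp, fderiv_quarticA,
        fderiv_quarticB, D.bracket_swap p.1]
      module
    · rw [map_add, map_smul, map_smul, LinearMap.trace_id, trace_bracket_comp_J,
        inner_starProjection_self, smul_eq_mul, smul_eq_mul]
      ring
  · refine (congrArg (LinearMap.trace ℝ ℝ) (?_ : _ = (2 + 2 * D.quarticF W Wᗮ p -
      4 * quarticA W p * p.2.2⁻¹) • LinearMap.id)).trans (by simp)
    refine LinearMap.ext_ring ?_
    simp [-Submodule.starProjection_orthogonal_val, fderiv_quarticF _ _ hp, fderiv_quarticA,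
      fderiv_quarticB]
    field_simp
    ring

theorem laplacian_quarticF {p : V × Z × ℝ} (hp : p ∈ halfSpace V Z) :
    Riem.laplacian D.metric (coords V Z) (D.quarticF W Wᗮ) p =
      (Module.finrank ℝ V + 2 * Module.finrank ℝ Z + 4) * D.quarticF W Wᗮ p +
      (2 * Module.finrank ℝ Z - 2 + 2 * Module.finrank ℝ Wᗮ - Module.finrank ℝ V) *
        (‖Wᗮ.starProjection p.1‖ ^ 2 / (2 * p.2.2)) +
      (2 * Module.finrank ℝ Wᗮ - Module.finrank ℝ V - 4) := by
  have hp' : p.2.2 ≠ 0 := ne_of_gt hp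
  rw [D.laplacian_eq_trace hp (fun q hq => D.gradient_quarticF W hq)
    (hJ.hasFDerivAt_gradF hp).differentiableAt, hJ.trace_fderiv_gradF hp,
    norm_starProjection_orthogonal_sq, gradF]
  field_simp
  ring

end Swaps

end DamekRicci

namespace DamekRicci

/-! ### Isoparametricity -/

section Isoparametric

variable {V Z : Type*} [NormedAddCommGroup V] [InnerProductSpace ℝ V]
  [NormedAddCommGroup Z] [InnerProductSpace ℝ Z] {D : DamekRicci V Z} {W : Submodule ℝ V}

theorem J_injective (D : DamekRicci V Z) {z : Z} (hz : z ≠ 0) : Function.Injective (D.J z) := by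
  refine (injective_iff_map_eq_zero _).2 fun v hv => ?_
  have h := D.norm_J z v
  rw [hv, norm_zero, zero_eq_mul, norm_eq_zero, norm_eq_zero] at h
  exact h.resolve_left hz

variable [FiniteDimensional ℝ V]

theorem finrank_le_of_J_mem {U : Submodule ℝ V} {z : Z} (hz : z ≠ 0)
    (h : ∀ v ∈ W, D.J z v ∈ U) : Module.finrank ℝ W ≤ Module.finrank ℝ U :=
  LinearMap.finrank_le_finrank_of_injective (f := (D.J z).restrict h) fun _ _ hxy =>
    Subtype.ext (D.J_injective hz (congrArg Subtype.val hxy))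

namespace Swaps

variable (hJ : D.Swaps W)
include hJ

theorem finrank_orthogonal [Nontrivial Z] : Module.finrank ℝ Wᗮ = Module.finrank ℝ W := by
  obtain ⟨z, hz⟩ := exists_ne (0 : Z)
  exact le_antisymm (finrank_le_of_J_mem hz (hJ.2 z)) (finrank_le_of_J_mem hz (hJ.1 z))

theorem finrank_eq_two_mul [Nontrivial Z] : Module.finrank ℝ V = 2 * Module.finrank ℝ W := by
  rw [← W.finrank_add_finrank_orthogonal, hJ.finrank_orthogonal, two_mul]

variable [FiniteDimensional ℝ Z]

theorem laplacian_quarticF_of_nontrivial [Nontrivial Z] {p : V × Z × ℝ} (hp : p ∈ halfSpace V Z) :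
    Riem.laplacian D.metric (coords V Z) (D.quarticF W Wᗮ) p =
      (Module.finrank ℝ V + 2 * Module.finrank ℝ Z + 4) * D.quarticF W Wᗮ p +
        (Module.finrank ℝ Z - 1) * (‖Wᗮ.starProjection p.1‖ ^ 2 / p.2.2) - 4 := by
  have hp' : p.2.2 ≠ 0 := ne_of_gt hp
  rw [hJ.laplacian_quarticF hp, hJ.finrank_orthogonal, hJ.finrank_eq_two_mul, Nat.cast_mul,
    Nat.cast_two]
  field_simp
  ring

theorem isIsoparametric (hZ : Module.finrank ℝ Z = 1) :
    D.IsIsoparametric (D.quarticF W Wᗮ) := by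
  have : Nontrivial Z := Module.nontrivial_of_finrank_pos (R := ℝ) (by omega)
  refine ⟨hJ.isTransnormal, fun c => (Module.finrank ℝ V + 6) * c - 4, by fun_prop,
    fun p hp => ?_⟩
  rw [hJ.laplacian_quarticF_of_nontrivial hp, hZ]
  ring

end Swaps

theorem finrank_eq_one_of_isIsoparametric [FiniteDimensional ℝ Z] [Nontrivial Z] [Nontrivial V]
    (h : D.IsIsoparametric (D.quarticF W Wᗮ)) : Module.finrank ℝ Z = 1 := by
  have hJ := swaps_of_isTransnormal h.1
  obtain ⟨-, α, -, hα⟩ := h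
  have hpos : 0 < Module.finrank ℝ V := Module.finrank_pos
  have hW : Wᗮ ≠ ⊥ := Submodule.one_le_finrank_iff.1 <| by
    rw [hJ.finrank_orthogonal]
    have := hJ.finrank_eq_two_mul
    omega
  obtain ⟨y, hy, hy0⟩ := Wᗮ.exists_mem_ne_zero_of_ne_bot hW
  have hpy := mem_halfSpace_one y (0 : Z)
  obtain ⟨w, hw⟩ := exists_quarticF_eq (D := D) (W := W) (D.one_le_quarticF W hpy)
  have hpw := mem_halfSpace_one (0 : V) w
  have hΔ := (hα _ hpy).trans ((congrArg α hw.symm).trans (hα _ hpw).symm)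
  rw [hJ.laplacian_quarticF_of_nontrivial hpy, hJ.laplacian_quarticF_of_nontrivial hpw, hw,
    Wᗮ.starProjection_eq_self_iff.2 hy, map_zero, norm_zero] at hΔ
  have hm : ((Module.finrank ℝ Z : ℝ) - 1) * ‖y‖ ^ 2 = 0 := by linarith
  have hm' := (mul_eq_zero.1 hm).resolve_right (pow_ne_zero 2 (norm_ne_zero_iff.2 hy0))
  exact_mod_cast sub_eq_zero.1 hm'

end Isoparametric

/-! ### Maximal totally real subspaces -/

theorem complexHyperbolic_swaps_iff {k : ℕ}
    {U : Submodule ℝ (EuclideanSpace ℂ (Fin (k - 1)))} :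
    (complexHyperbolic k).Swaps U ↔
      (∀ x ∈ U, Complex.I • x ∈ Uᗮ) ∧ ∀ y ∈ Uᗮ, Complex.I • y ∈ U := by
  simp only [Swaps, complexHyperbolic_J]
  exact ⟨fun h => ⟨fun x hx => by simpa using h.1 1 x hx, fun y hy => by simpa using h.2 1 y hy⟩,
    fun h => ⟨fun z x hx => Uᗮ.smul_mem z (h.1 x hx), fun z y hy => U.smul_mem z (h.2 y hy)⟩⟩

theorem inner_I_smul_left {k : ℕ} (v w : EuclideanSpace ℂ (Fin (k - 1))) :
    ⟪Complex.I • v, w⟫_ℝ = -⟪v, Complex.I • w⟫_ℝ := by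
  simpa [complexHyperbolic_J] using (complexHyperbolic k).inner_J_left 1 v w

theorem isTotallyReal_iff {k : ℕ} {U : Submodule ℝ (EuclideanSpace ℂ (Fin (k - 1)))} :
    IsTotallyReal U ↔ ∀ x ∈ U, Complex.I • x ∈ Uᗮ :=
  forall₂_congr fun _ _ => (U.mem_orthogonal' _).symm

theorem IsTotallyReal.sup_span_singleton {k : ℕ}
    {U : Submodule ℝ (EuclideanSpace ℂ (Fin (k - 1)))} (hU : IsTotallyReal U)
    {z : EuclideanSpace ℂ (Fin (k - 1))} (hz : Complex.I • z ∈ Uᗮ) :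
    IsTotallyReal (U ⊔ Submodule.span ℝ {z}) := by
  intro x hx y hy
  obtain ⟨x', hx', _, ha, rfl⟩ := Submodule.mem_sup.1 hx
  obtain ⟨y', hy', _, hb, rfl⟩ := Submodule.mem_sup.1 hy
  obtain ⟨a, rfl⟩ := Submodule.mem_span_singleton.1 ha
  obtain ⟨b, rfl⟩ := Submodule.mem_span_singleton.1 hb
  have hzz : ⟪Complex.I • z, z⟫_ℝ = 0 := by
    simpa [complexHyperbolic_J] using (complexHyperbolic k).inner_J_self 1 z
  have hxz : ⟪Complex.I • x', z⟫_ℝ = 0 := by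
    rw [inner_I_smul_left, Submodule.inner_right_of_mem_orthogonal hx' hz, neg_zero]
  have hzy := Submodule.inner_left_of_mem_orthogonal hy' hz
  simp only [smul_add, smul_comm Complex.I, inner_add_left, inner_add_right,
    real_inner_smul_left, real_inner_smul_right, hU x' hx' y' hy', hxz, hzy, hzz, mul_zero,
    add_zero]

theorem maximal_isTotallyReal_iff {k : ℕ} {U : Submodule ℝ (EuclideanSpace ℂ (Fin (k - 1)))} :
    Maximal IsTotallyReal U ↔ (complexHyperbolic k).Swaps U := by
  have hII : ∀ v : EuclideanSpace ℂ (Fin (k - 1)), Complex.I • Complex.I • v = -v := fun v => by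
    rw [smul_smul, Complex.I_mul_I, neg_one_smul]
  rw [complexHyperbolic_swaps_iff]
  refine ⟨fun h => ?_, fun ⟨hU, hU'⟩ => ⟨isTotallyReal_iff.2 hU, fun U' hU'' hle w hw => ?_⟩⟩
  · have hU := isTotallyReal_iff.1 h.prop
    refine ⟨hU, fun y hy => ?_⟩
    -- The component `z` of `i y` orthogonal to `U` can be adjoined to `U`, so it vanishes.
    set z := Uᗮ.starProjection (Complex.I • y)
    have hz : Complex.I • y - U.starProjection (Complex.I • y) = z :=
      (U.starProjection_orthogonal_val _).symm
    have hIz : Complex.I • z ∈ Uᗮ := by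
      rw [← hz, smul_sub, hII]
      exact Uᗮ.sub_mem (Uᗮ.neg_mem hy) (hU _ (U.starProjection_apply_mem _))
    have hzU : z ∈ U := h.le_of_ge (h.prop.sup_span_singleton hIz) le_sup_left
      (Submodule.mem_sup_right (Submodule.mem_span_singleton_self z))
    have hz0 : z = 0 := inner_self_eq_zero (𝕜 := ℝ).1
      (Submodule.inner_right_of_mem_orthogonal hzU (Uᗮ.starProjection_apply_mem _))
    rw [sub_eq_zero.1 (hz.trans hz0)]
    exact U.starProjection_apply_mem _
  · rw [← U.orthogonal_orthogonal]
    refine (Submodule.mem_orthogonal _ _).2 fun y hy => ?_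
    have h := hU'' _ (hle (hU' y hy)) w hw
    rwa [hII, inner_neg_left, neg_eq_zero] at h

section Iso

variable {V Z : Type*} [NormedAddCommGroup V] [InnerProductSpace ℝ V]
  [NormedAddCommGroup Z] [InnerProductSpace ℝ Z] {D : DamekRicci V Z} {W : Submodule ℝ V}

theorem Iso.swaps_map_iff {V' Z' : Type*} [NormedAddCommGroup V'] [InnerProductSpace ℝ V']
    [NormedAddCommGroup Z'] [InnerProductSpace ℝ Z'] {D' : DamekRicci V' Z'} (e : D.Iso D') :
    D'.Swaps (W.map e.mapV.toLinearEquiv.toLinearMap) ↔ D.Swaps W := by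
  have h : ∀ U U' : Submodule ℝ V,
      (∀ z, ∀ v ∈ U.map e.mapV.toLinearEquiv.toLinearMap,
        D'.J z v ∈ U'.map e.mapV.toLinearEquiv.toLinearMap) ↔ ∀ z, ∀ v ∈ U, D.J z v ∈ U' := by
    intro U U'
    refine e.mapZ.surjective.forall.trans (forall_congr' fun z => Set.forall_mem_image.trans
      (forall₂_congr fun v _ => ?_))
    change D'.J (e.mapZ z) (e.mapV v) ∈ e.mapV '' (U' : Set V) ↔ _
    rw [← e.map_J, e.mapV.injective.mem_set_image, SetLike.mem_coe]
  rw [Swaps, Swaps, ← Submodule.map_orthogonal_equiv, h, h]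

theorem isMaximalTotallyReal_iff_swaps {k : ℕ} (e : D.Iso (complexHyperbolic k)) :
    IsMaximalTotallyReal e W ↔ D.Swaps W :=
  maximal_isTotallyReal_iff.trans e.swaps_map_iff

theorem Iso.finrank_eq_one {k : ℕ} (e : D.Iso (complexHyperbolic k)) :
    Module.finrank ℝ Z = 1 :=
  e.mapZ.toLinearEquiv.finrank_eq.trans (Module.finrank_self ℝ)

theorem Swaps.finrank_add_one_eq [FiniteDimensional ℝ V] (hJ : D.Swaps W) {k : ℕ} (hk : 1 ≤ k)
    (e : D.Iso (complexHyperbolic k)) : Module.finrank ℝ W + 1 = k := by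
  have : Nontrivial Z := e.mapZ.toEquiv.nontrivial
  have h := e.mapV.toLinearEquiv.finrank_eq
  rw [hJ.finrank_eq_two_mul, finrank_real_of_complex, finrank_euclideanSpace_fin] at h
  omega

/-- The real linear map `ℂ^d → V` with `a + i b ↦ T a + j (T b)`, the extension of `T` to a complex
linear map when `j` is a complex structure on `V`. -/
def complexify {d : ℕ} (T : EuclideanSpace ℝ (Fin d) →ₗ[ℝ] V) (j : V →ₗ[ℝ] V) :
    EuclideanSpace ℂ (Fin d) →ₗ[ℝ] V where
  toFun w := T (WithLp.toLp 2 fun l => (w l).re) + j (T (WithLp.toLp 2 fun l => (w l).im))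
  map_add' w w' := by
    simp only [PiLp.add_apply, Complex.add_re, Complex.add_im, ← Pi.add_def, WithLp.toLp_add,
      map_add]
    abel
  map_smul' c w := by
    simp only [PiLp.smul_apply, Complex.smul_re, Complex.smul_im, ← Pi.smul_def, WithLp.toLp_smul,
      map_smul, RingHom.id_apply, smul_add]

theorem complexify_I_smul {d : ℕ} (T : EuclideanSpace ℝ (Fin d) →ₗ[ℝ] V) {j : V →ₗ[ℝ] V}
    (hj : ∀ v, j (j v) = -v) (w : EuclideanSpace ℂ (Fin d)) :
    complexify T j (Complex.I • w) = j (complexify T j w) := by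
  simp [complexify, hj, ← Pi.neg_def]
  abel

theorem norm_complexify {d : ℕ} (T : EuclideanSpace ℝ (Fin d) →ₗᵢ[ℝ] V) {j : V →ₗ[ℝ] V}
    (hj : ∀ v, ‖j v‖ = ‖v‖) (hT : ∀ a b, ⟪T a, j (T b)⟫_ℝ = 0) (w : EuclideanSpace ℂ (Fin d)) :
    ‖complexify T.toLinearMap j w‖ = ‖w‖ := by
  rw [← sq_eq_sq₀ (norm_nonneg _) (norm_nonneg _), EuclideanSpace.norm_sq_eq, complexify]
  simp only [LinearMap.coe_mk, AddHom.coe_mk, LinearIsometry.coe_toLinearMap]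
  rw [sq, norm_add_sq_eq_norm_sq_add_norm_sq_real (hT _ _), hj, T.norm_map, T.norm_map, ← sq,
    ← sq, EuclideanSpace.norm_sq_eq, EuclideanSpace.norm_sq_eq, ← Finset.sum_add_distrib]
  refine Finset.sum_congr rfl fun l _ => ?_
  rw [Complex.sq_norm, Complex.normSq_apply, Real.norm_eq_abs, Real.norm_eq_abs, sq_abs, sq_abs,
    sq, sq]

theorem Swaps.exists_linearIsometryEquiv [FiniteDimensional ℝ V] (hJ : D.Swaps W) {i : Z}
    (hi : ‖i‖ = 1) : ∃ φ : EuclideanSpace ℂ (Fin (Module.finrank ℝ W)) ≃ₗᵢ[ℝ] V,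
      ∀ w, φ (Complex.I • w) = D.J i (φ w) := by
  have : Nontrivial Z := ⟨i, 0, by rintro rfl; simp at hi⟩
  have hjj : ∀ v, D.J i (D.J i v) = -v := fun v => by rw [J_J, hi, one_pow, neg_one_smul]
  have hj : ∀ v, ‖D.J i v‖ = ‖v‖ := fun v => by rw [norm_J, hi, one_mul]
  let T : EuclideanSpace ℝ (Fin (Module.finrank ℝ W)) →ₗᵢ[ℝ] V :=
    W.subtypeₗᵢ.comp (stdOrthonormalBasis ℝ W).repr.symm.toLinearIsometry
  have hT : ∀ a b, ⟪T a, D.J i (T b)⟫_ℝ = 0 := fun a b =>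
    Submodule.inner_right_of_mem_orthogonal (SetLike.coe_mem _) (hJ.1 i _ (SetLike.coe_mem _))
  let φ : EuclideanSpace ℂ (Fin (Module.finrank ℝ W)) →ₗᵢ[ℝ] V :=
    ⟨complexify T.toLinearMap (D.J i), norm_complexify T hj hT⟩
  refine ⟨φ.toLinearIsometryEquiv ?_, fun w => complexify_I_smul T.toLinearMap hjj w⟩
  rw [finrank_real_of_complex, finrank_euclideanSpace_fin, hJ.finrank_eq_two_mul]

theorem Swaps.nonempty_iso_complexHyperbolic [FiniteDimensional ℝ V] (hJ : D.Swaps W)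
    (hZ : Module.finrank ℝ Z = 1) :
    Nonempty (D.Iso (complexHyperbolic (Module.finrank ℝ W + 1))) := by
  have : FiniteDimensional ℝ Z := Module.finite_of_finrank_eq_succ hZ
  have : Nontrivial Z := Module.nontrivial_of_finrank_pos (R := ℝ) (by omega)
  obtain ⟨i, hi⟩ := exists_norm_eq Z zero_le_one
  obtain ⟨φ, hφ⟩ := hJ.exists_linearIsometryEquiv hi
  let ψ : ℝ ≃ₗᵢ[ℝ] Z := (LinearIsometry.toSpanSingleton ℝ Z hi).toLinearIsometryEquiv
    ((Module.finrank_self ℝ).trans hZ.symm)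
  refine ⟨⟨φ.symm, ψ.symm, fun z v => φ.injective ?_⟩⟩
  obtain ⟨c, rfl⟩ := ψ.surjective z
  have hc : ψ c = c • i := rfl
  rw [φ.apply_symm_apply, ψ.symm_apply_apply, hc]
  refine Eq.trans ?_ (congrArg φ (complexHyperbolic_J (Module.finrank ℝ W + 1) c (φ.symm v)).symm)
  rw [map_smul φ, hφ, φ.apply_symm_apply, map_smul, LinearMap.smul_apply]

theorem isIsoparametric_quarticF_iff [FiniteDimensional ℝ V] [FiniteDimensional ℝ Z]
    (hZ : Module.finrank ℝ Z ≠ 0) (hV : Module.finrank ℝ V ≠ 0 ∨ Module.finrank ℝ Z = 1) :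
    D.IsIsoparametric (D.quarticF W Wᗮ) ↔
      ∃ k : ℕ, 1 ≤ k ∧ ∃ e : D.Iso (complexHyperbolic k), IsMaximalTotallyReal e W := by
  constructor
  · intro h
    have : Nontrivial Z := Module.nontrivial_of_finrank_pos (R := ℝ) (Nat.pos_of_ne_zero hZ)
    have hZ1 : Module.finrank ℝ Z = 1 := hV.elim (fun hV =>
      have : Nontrivial V := Module.nontrivial_of_finrank_pos (R := ℝ) (Nat.pos_of_ne_zero hV)
      finrank_eq_one_of_isIsoparametric h) id
    have hJ := swaps_of_isTransnormal h.1
    obtain ⟨e⟩ := hJ.nonempty_iso_complexHyperbolic hZ1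
    exact ⟨_, Nat.le_add_left _ _, e, (isMaximalTotallyReal_iff_swaps e).2 hJ⟩
  · rintro ⟨k, -, e, he⟩
    exact ((isMaximalTotallyReal_iff_swaps e).1 he).isIsoparametric e.finrank_eq_one

end Iso

end DamekRicci

namespace DamekRicci

/-! ### The slices `{(v, 0, t) : v ∈ W}` -/

section Slice

variable {V Z : Type*} [NormedAddCommGroup V] [InnerProductSpace ℝ V] [FiniteDimensional ℝ V]
  [NormedAddCommGroup Z] [InnerProductSpace ℝ Z] [FiniteDimensional ℝ Z]

theorem metric_self_of_subsingleton [Subsingleton Z] (D : DamekRicci V Z) (p X : V × Z × ℝ) :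
    D.metric p X X = 1 / p.2.2 * ‖X.1‖ ^ 2 + X.2.2 ^ 2 / p.2.2 ^ 2 := by
  rw [metric, real_inner_self_eq_norm_sq, Subsingleton.elim (X.2.1 + _) 0, inner_zero_left,
    mul_zero, add_zero, ← sq]

variable {D : DamekRicci V Z}

theorem dist_map_of_bracket_eq_zero {V' Z' : Type*} [NormedAddCommGroup V']
    [InnerProductSpace ℝ V'] [FiniteDimensional ℝ V'] [NormedAddCommGroup Z']
    [InnerProductSpace ℝ Z'] [FiniteDimensional ℝ Z'] [Subsingleton Z'] (D' : DamekRicci V' Z')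
    (φ : V' →ₗᵢ[ℝ] V) (hφ : ∀ x y, D.bracket (φ x) (φ y) = 0) {p q : V' × Z' × ℝ}
    (hp : p ∈ halfSpace V' Z') (hq : q ∈ halfSpace V' Z') :
    D.dist (φ p.1, 0, p.2.2) (φ q.1, 0, q.2.2) = D'.dist p q := by
  let φ' := φ.toContinuousLinearMap
  -- The orthogonal projection `(v, z, t) ↦ (φ* v, 0, t)` is a retraction that shortens vectors.
  have hnorm : ∀ v, ‖φ'.adjoint v‖ ≤ ‖v‖ := fun v =>
    (φ'.adjoint.le_opNorm v).trans (mul_le_of_le_one_left (norm_nonneg v)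
      ((LinearIsometryEquiv.norm_map _ _).trans_le φ.norm_toContinuousLinearMap_le))
  have hπf : ∀ x, φ'.adjoint (φ x) = x := fun x => ext_inner_right ℝ fun y => by
    rw [ContinuousLinearMap.adjoint_inner_left]
    exact φ.inner_map_map x y
  refine Riem.dist_map_eq_of_retraction convex_halfSpace convex_halfSpace D'.continuousOn_metric
    D.continuousOn_metric (φ'.prodMap ((0 : Z' →L[ℝ] Z).prodMap (.id ℝ ℝ)))
    (φ'.adjoint.prodMap ((0 : Z →L[ℝ] Z').prodMap (.id ℝ ℝ))) (fun _ h => h) (fun _ h => h)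
    (fun p => Prod.ext (hπf p.1) (Prod.ext (Subsingleton.elim _ _) rfl)) (fun p _ X => ?_)
    (fun p hp X => ?_) hp hq
  · rw [D'.metric_self_of_subsingleton]
    simp [metric, φ', hφ, ← sq]
  · have hp' : 0 < p.2.2 := hp
    rw [D'.metric_self_of_subsingleton, metric]
    simp only [real_inner_self_eq_norm_sq, ← sq]
    exact add_le_add_left (le_add_of_le_of_nonneg (mul_le_mul_of_nonneg_left
      (pow_le_pow_left₀ (norm_nonneg _) (hnorm X.1) 2) (by positivity)) (by positivity)) _

theorem isRealHyperbolicSubspace_slice {W : Submodule ℝ V}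
    (hW : ∀ x ∈ W, ∀ y ∈ W, D.bracket x y = 0) :
    D.IsRealHyperbolicSubspace (Module.finrank ℝ W + 1) (slice Z W) := by
  let φ : W ≃ₗᵢ[ℝ] EuclideanSpace ℝ (Fin (Module.finrank ℝ W + 1 - 1)) :=
    (stdOrthonormalBasis ℝ W).repr
  refine ⟨fun p => (φ.symm p.1, 0, p.2.2), Set.Subset.antisymm ?_ ?_, fun p hp q hq =>
    dist_map_of_bracket_eq_zero _ (W.subtypeₗᵢ.comp φ.symm.toLinearIsometry)
      (fun x y => hW _ (SetLike.coe_mem _) _ (SetLike.coe_mem _)) hp hq⟩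
  · rintro _ ⟨p, hp, rfl⟩
    exact ⟨hp, (φ.symm p.1).2, rfl⟩
  · rintro ⟨v, z, t⟩ ⟨ht, hv, rfl⟩
    exact ⟨(φ ⟨v, hv⟩, 0, t), ht, by simp⟩

end Slice

end DamekRicci

/-! ### Tubes about the slice -/

theorem hasDerivAt_arcosh_sqrt {c : ℝ} (hc : 1 < c) :
    HasDerivAt (fun c => Real.arcosh √c) (2 * √(c * (c - 1)))⁻¹ c := by
  have h := (Real.hasDerivAt_arcosh (Real.lt_sqrt_of_sq_lt (by simpa using hc))).comp c
    (Real.hasDerivAt_sqrt (zero_lt_one.trans hc).ne')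
  refine h.congr_deriv ?_
  rw [Real.sq_sqrt (by linarith), Real.sqrt_mul (by linarith)]
  field_simp

theorem integral_two_mul_div_one_sub_sq {T : ℝ} (hT₀ : 0 ≤ T) (hT : T < 1) :
    ∫ s in (0 : ℝ)..1, 2 * T / (1 - s ^ 2 * T ^ 2) = 2 * Real.artanh T := by
  have hsT : ∀ s ∈ Set.uIcc (0 : ℝ) 1, 0 ≤ s * T ∧ s * T < 1 := fun s hs => by
    rw [Set.uIcc_of_le zero_le_one] at hs
    exact ⟨mul_nonneg hs.1 hT₀, (mul_le_of_le_one_left hT₀ hs.2).trans_lt hT⟩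
  have hderiv : ∀ s ∈ Set.uIcc (0 : ℝ) 1, HasDerivAt
      (fun s => Real.log (1 + s * T) - Real.log (1 - s * T)) (2 * T / (1 - s ^ 2 * T ^ 2)) s :=
    fun s hs => by
      obtain ⟨h0, h1⟩ := hsT s hs
      have hp : 1 + s * T ≠ 0 := by linarith
      have hm : 1 - s * T ≠ 0 := by linarith
      have hd : HasDerivAt (fun s : ℝ => s * T) T s := by simpa using (hasDerivAt_id s).mul_const T
      refine (((hd.const_add 1).log hp).sub ((hd.const_sub 1).log hm)).congr_deriv ?_
      rw [div_sub_div _ _ hp hm]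
      congr 1 <;> ring
  have hcont : ContinuousOn (fun s : ℝ => 2 * T / (1 - s ^ 2 * T ^ 2)) (Set.uIcc 0 1) := by
    have hne : ∀ s ∈ Set.uIcc (0 : ℝ) 1, 1 - s ^ 2 * T ^ 2 ≠ 0 := fun s hs => by
      nlinarith [hsT s hs]
    fun_prop (disch := assumption)
  rw [intervalIntegral.integral_eq_sub_of_hasDerivAt hderiv hcont.intervalIntegrable,
    Real.artanh_eq_half_log ⟨by linarith, hT.le⟩, Real.log_div (by linarith) (by linarith)]
  simp

theorem one_add_cosh_mul_tanh_half_sq (r : ℝ) :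
    (1 + Real.cosh r) * Real.tanh (r / 2) ^ 2 = Real.cosh r - 1 := by
  have h : Real.cosh r = 2 * Real.cosh (r / 2) ^ 2 - 1 := by
    have h := Real.cosh_two_mul (r / 2)
    rw [Real.sinh_sq, mul_div_cancel₀ r two_ne_zero] at h
    linarith
  rw [h, Real.tanh_eq_sinh_div_cosh, div_pow, Real.sinh_sq]
  field_simp [(Real.cosh_pos (r / 2)).ne']
  ring

theorem exists_smul_eq_of_sq_add_norm_sq {E : Type*} [NormedAddCommGroup E] [NormedSpace ℝ E]
    {a c : ℝ} {b : E} (ha : 0 < a) (hc : 0 ≤ c) (h : a ^ 2 + ‖b‖ ^ 2 = c ^ 2) :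
    ∃ k : E, (a + c) • k = b ∧ (a + c) * ‖k‖ ^ 2 = c - a := by
  have hac : a + c ≠ 0 := by positivity
  refine ⟨(a + c)⁻¹ • b, smul_inv_smul₀ hac b, ?_⟩
  rw [norm_smul, mul_pow, norm_inv, Real.norm_eq_abs, inv_pow, sq_abs]
  field_simp
  linarith

namespace DamekRicci

variable {V Z : Type*} [NormedAddCommGroup V] [InnerProductSpace ℝ V] [FiniteDimensional ℝ V]
  [NormedAddCommGroup Z] [InnerProductSpace ℝ Z] [FiniteDimensional ℝ Z]

section LowerBound

variable {D : DamekRicci V Z} {W : Submodule ℝ V}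

theorem Swaps.abs_fderiv_quarticF_le (hJ : D.Swaps W) {p : V × Z × ℝ} (hp : p ∈ halfSpace V Z)
    (X : V × Z × ℝ) : |fderiv ℝ (D.quarticF W Wᗮ) p X| ≤
      2 * √(D.quarticF W Wᗮ p * (D.quarticF W Wᗮ p - 1)) * √(D.metric p X X) := by
  have h := D.gradNormSq_quarticF W hp
  rw [Riem.gradNormSq, D.gradient_quarticF W hp, hJ.eikonalDefect_eq_zero, zero_div, add_zero,
    mul_assoc] at h
  have h4 : √(4 : ℝ) = 2 := by
    rw [show (4 : ℝ) = 2 ^ 2 by norm_num, Real.sqrt_sq zero_le_two]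
  rw [← D.metric_gradF W hp, ← h4, ← Real.sqrt_mul zero_le_four, ← h]
  exact D.abs_metric_le hp _ _

/-- Since `F` satisfies the eikonal equation `‖∇F‖² = 4F(F - 1)`, the function `arcosh √(F + ε)` is
`1`-Lipschitz for `ε > 0`; the shift makes it differentiable where `F = 1`. -/
theorem Swaps.arcosh_sub_arcosh_le_dist_of_pos (hJ : D.Swaps W) {p q : V × Z × ℝ}
    (hp : p ∈ halfSpace V Z) (hq : q ∈ halfSpace V Z) {ε : ℝ} (hε : 0 < ε) :
    Real.arcosh √(D.quarticF W Wᗮ p + ε) - Real.arcosh √(D.quarticF W Wᗮ q + ε) ≤ D.dist p q := by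
  have hderiv : ∀ p ∈ halfSpace V Z, HasFDerivAt
      (fun p => Real.arcosh √(D.quarticF W Wᗮ p + ε))
      ((2 * √((D.quarticF W Wᗮ p + ε) * (D.quarticF W Wᗮ p + ε - 1)))⁻¹ •
        fderiv ℝ (D.quarticF W Wᗮ) p) p := fun p hp =>
    HasDerivAt.comp_hasFDerivAt (h₂ := fun c => Real.arcosh √c)
      (f := fun p => D.quarticF W Wᗮ p + ε) p
      (hasDerivAt_arcosh_sqrt (lt_add_of_le_of_pos (D.one_le_quarticF W hp) hε))
      ((D.differentiableAt_quarticF W hp).hasFDerivAt.add_const ε)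
  refine Riem.sub_le_dist (f := fun p => Real.arcosh √(D.quarticF W Wᗮ p + ε)) convex_halfSpace
    D.continuousOn_metric (fun p hp => (hderiv p hp).differentiableAt) (fun p hp X => ?_) hp hq
  have hF := D.one_le_quarticF W hp
  have hpos : 0 < √((D.quarticF W Wᗮ p + ε) * (D.quarticF W Wᗮ p + ε - 1)) :=
    Real.sqrt_pos.2 (mul_pos (by linarith) (by linarith))
  rw [(hderiv p hp).fderiv, _root_.smul_apply, smul_eq_mul, abs_mul, abs_inv,
    abs_of_pos (by positivity), inv_mul_le_iff₀ (by positivity)]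
  refine (hJ.abs_fderiv_quarticF_le hp X).trans ?_
  gcongr <;> linarith

theorem Swaps.arcosh_sub_arcosh_le_dist (hJ : D.Swaps W) {p q : V × Z × ℝ}
    (hp : p ∈ halfSpace V Z) (hq : q ∈ halfSpace V Z) :
    Real.arcosh √(D.quarticF W Wᗮ p) - Real.arcosh √(D.quarticF W Wᗮ q) ≤ D.dist p q := by
  have hcont : ∀ {c : ℝ}, 1 ≤ c → Filter.Tendsto (fun ε => Real.arcosh √(c + ε))
      (nhdsWithin 0 (Set.Ioi 0)) (nhds (Real.arcosh √c)) := fun {c} hc => by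
    have h : ContinuousOn (fun ε => Real.arcosh √(c + ε)) (Set.Ici 0) :=
      Real.continuousOn_arcosh.comp (by fun_prop) fun ε hε =>
        Real.one_le_sqrt.2 (le_add_of_le_of_nonneg hc hε)
    simpa using ((h 0 Set.self_mem_Ici).mono Set.Ioi_subset_Ici_self).tendsto
  exact le_of_tendsto ((hcont (D.one_le_quarticF W hp)).sub (hcont (D.one_le_quarticF W hq)))
    (Filter.eventually_of_mem self_mem_nhdsWithin
      fun ε hε => hJ.arcosh_sub_arcosh_le_dist_of_pos hp hq hε)

end LowerBound

end DamekRicci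

namespace DamekRicci

variable {V Z : Type*} [NormedAddCommGroup V] [InnerProductSpace ℝ V] [FiniteDimensional ℝ V]
  [NormedAddCommGroup Z] [InnerProductSpace ℝ Z] [FiniteDimensional ℝ Z]

section NormalCurve

variable (D : DamekRicci V Z) (K : Z) (η x₀ : V) (t₀ T : ℝ)

/-- A geodesic that leaves the slice `{(v, 0, t) : v ∈ W}` orthogonally at `(x₀, 0, t₀)`, provided
that `η ∈ Wᗮ` and `‖η‖² = 4t₀(T² - ‖K‖²)`. The parametrization is rational, not by arc length. -/
def normalCurve (s : ℝ) : V × Z × ℝ :=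
  (x₀ + (s ^ 2 / (1 + s ^ 2 * ‖K‖ ^ 2)) • D.J K η + (s / (1 + s ^ 2 * ‖K‖ ^ 2)) • η,
    (s / (1 + s ^ 2 * ‖K‖ ^ 2)) • ((2 * t₀) • K + (1 / 2 : ℝ) • D.bracket x₀ η),
    t₀ * (1 - s ^ 2 * T ^ 2) / (1 + s ^ 2 * ‖K‖ ^ 2))

/-- The velocity of `normalCurve`. -/
def normalCurveVelocity (s : ℝ) : V × Z × ℝ :=
  ((2 * s / (1 + s ^ 2 * ‖K‖ ^ 2) ^ 2) • D.J K η +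
      ((1 - s ^ 2 * ‖K‖ ^ 2) / (1 + s ^ 2 * ‖K‖ ^ 2) ^ 2) • η,
    ((1 - s ^ 2 * ‖K‖ ^ 2) / (1 + s ^ 2 * ‖K‖ ^ 2) ^ 2) •
      ((2 * t₀) • K + (1 / 2 : ℝ) • D.bracket x₀ η),
    -2 * t₀ * s * (T ^ 2 + ‖K‖ ^ 2) / (1 + s ^ 2 * ‖K‖ ^ 2) ^ 2)

theorem contDiff_normalCurve {n : WithTop ℕ∞} : ContDiff ℝ n (D.normalCurve K η x₀ t₀ T) := by
  have h : ∀ s : ℝ, 1 + s ^ 2 * ‖K‖ ^ 2 ≠ 0 := fun s => by positivity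
  unfold normalCurve
  fun_prop (disch := assumption)

theorem hasDerivAt_normalCurve (s : ℝ) :
    HasDerivAt (D.normalCurve K η x₀ t₀ T) (D.normalCurveVelocity K η x₀ t₀ T s) s := by
  have hq : 1 + s ^ 2 * ‖K‖ ^ 2 ≠ 0 := by positivity
  have hs : HasDerivAt (fun s : ℝ => s) 1 s := hasDerivAt_id s
  have hs2 : HasDerivAt (fun s : ℝ => s ^ 2) (2 * s) s := (hs.pow 2).congr_deriv (by simp)
  have hqd : HasDerivAt (fun s : ℝ => 1 + s ^ 2 * ‖K‖ ^ 2) (2 * s * ‖K‖ ^ 2) s :=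
    (hs2.mul_const _).const_add 1
  have h₁ : HasDerivAt (fun s : ℝ => s / (1 + s ^ 2 * ‖K‖ ^ 2))
      ((1 - s ^ 2 * ‖K‖ ^ 2) / (1 + s ^ 2 * ‖K‖ ^ 2) ^ 2) s :=
    (hs.div hqd hq).congr_deriv (by ring)
  have h₂ : HasDerivAt (fun s : ℝ => s ^ 2 / (1 + s ^ 2 * ‖K‖ ^ 2))
      (2 * s / (1 + s ^ 2 * ‖K‖ ^ 2) ^ 2) s :=
    (hs2.div hqd hq).congr_deriv (by ring)
  have h₃ : HasDerivAt (fun s : ℝ => t₀ * (1 - s ^ 2 * T ^ 2) / (1 + s ^ 2 * ‖K‖ ^ 2))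
      (-2 * t₀ * s * (T ^ 2 + ‖K‖ ^ 2) / (1 + s ^ 2 * ‖K‖ ^ 2) ^ 2) s :=
    ((((hs2.mul_const (T ^ 2)).const_sub 1).const_mul t₀).div hqd hq).congr_deriv (by ring)
  exact (((h₂.smul_const _).const_add x₀).add (h₁.smul_const η)).prodMk
    ((h₁.smul_const _).prodMk h₃)

theorem normalCurve_zero : D.normalCurve K η x₀ t₀ T 0 = (x₀, 0, t₀) := by
  simp [normalCurve]

theorem normalCurve_one (x y : V) (u : ℝ) :
    D.normalCurve K ((1 + ‖K‖ ^ 2) • y) (x - D.J K y) ((1 + ‖K‖ ^ 2) * u) T 1 =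
      (x + y, (2 * u + 1 / 2 * ‖y‖ ^ 2) • K + (1 / 2 : ℝ) • D.bracket x y, u * (1 - T ^ 2)) := by
  have hq : 1 + ‖K‖ ^ 2 ≠ 0 := by positivity
  simp only [normalCurve, one_pow, one_mul, map_smul, bracket_sub_left, bracket_smul_right,
    bracket_J_self]
  refine Prod.ext ?_ (Prod.ext ?_ ?_)
  · match_scalars <;> field_simp
    ring
  · match_scalars <;> field_simp
  · field_simp

theorem norm_normalCurveVelocity_fst_sq (s : ℝ) :
    ‖(D.normalCurveVelocity K η x₀ t₀ T s).1‖ ^ 2 = ‖η‖ ^ 2 / (1 + s ^ 2 * ‖K‖ ^ 2) ^ 2 := by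
  simp only [normalCurveVelocity, norm_add_sq_real, real_inner_smul_left, real_inner_smul_right,
    inner_J_self, norm_smul, norm_J, mul_pow, Real.norm_eq_abs, sq_abs]
  field_simp
  ring

variable {D K η x₀ t₀ T} {W : Submodule ℝ V} (hJ : D.Swaps W) (hη : η ∈ Wᗮ)
include hJ hη

theorem Swaps.normalCurveVelocity_add_bracket (hx₀ : x₀ ∈ W)
    (hnorm : ‖η‖ ^ 2 = 4 * t₀ * (T ^ 2 - ‖K‖ ^ 2)) (s : ℝ) :
    (D.normalCurveVelocity K η x₀ t₀ T s).2.1 + (1 / 2 : ℝ) •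
      D.bracket (D.normalCurveVelocity K η x₀ t₀ T s).1 (D.normalCurve K η x₀ t₀ T s).1 =
      (2 * t₀ * (1 - s ^ 2 * T ^ 2) / (1 + s ^ 2 * ‖K‖ ^ 2) ^ 2) • K := by
  simp only [normalCurveVelocity, normalCurve, bracket_add_left, bracket_add_right,
    bracket_smul_left, bracket_smul_right, hJ.bracket_eq_zero (hJ.2 K η hη) hx₀,
    hJ.bracket_eq_zero (hJ.2 K η hη) (hJ.2 K η hη), hJ.bracket_orthogonal_eq_zero hη hη,
    D.bracket_swap η x₀, D.bracket_swap η (D.J K η), bracket_J_self, hnorm]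
  match_scalars <;> field_simp <;> ring

theorem Swaps.metric_normalCurveVelocity (hx₀ : x₀ ∈ W) (ht₀ : 0 < t₀)
    (hnorm : ‖η‖ ^ 2 = 4 * t₀ * (T ^ 2 - ‖K‖ ^ 2)) {s : ℝ} (hs : 0 < 1 - s ^ 2 * T ^ 2) :
    D.metric (D.normalCurve K η x₀ t₀ T s) (D.normalCurveVelocity K η x₀ t₀ T s)
      (D.normalCurveVelocity K η x₀ t₀ T s) = (2 * T / (1 - s ^ 2 * T ^ 2)) ^ 2 := by
  rw [metric, real_inner_self_eq_norm_sq, norm_normalCurveVelocity_fst_sq,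
    hJ.normalCurveVelocity_add_bracket hη hx₀ hnorm, hnorm, real_inner_smul_left,
    real_inner_smul_right, real_inner_self_eq_norm_sq]
  simp only [normalCurveVelocity, normalCurve]
  field_simp
  ring

theorem Swaps.dist_normalCurve_le (hx₀ : x₀ ∈ W) (ht₀ : 0 < t₀) (hT₀ : 0 ≤ T) (hT : T < 1)
    (hnorm : ‖η‖ ^ 2 = 4 * t₀ * (T ^ 2 - ‖K‖ ^ 2)) :
    D.dist (x₀, 0, t₀) (D.normalCurve K η x₀ t₀ T 1) ≤ 2 * Real.artanh T := by
  have hpos : ∀ s ∈ Set.Icc (0 : ℝ) 1, 0 < 1 - s ^ 2 * T ^ 2 := fun s hs => by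
    rw [sub_pos, ← mul_pow]
    exact pow_lt_one₀ (mul_nonneg hs.1 hT₀) ((mul_le_of_le_one_left hT₀ hs.2).trans_lt hT)
      two_ne_zero
  have hγ : Riem.IsCurveIn (halfSpace V Z) (D.normalCurve K η x₀ t₀ T) :=
    ⟨(D.contDiff_normalCurve K η x₀ t₀ T).contDiffOn, fun s hs =>
      div_pos (mul_pos ht₀ (hpos s hs)) (by positivity)⟩
  refine (Riem.dist_le_curveLength hγ (D.normalCurve_zero K η x₀ t₀ T) rfl).trans_eq ?_
  rw [← integral_two_mul_div_one_sub_sq hT₀ hT, Riem.curveLength_eq]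
  refine intervalIntegral.integral_congr fun s hs => ?_
  rw [Set.uIcc_of_le zero_le_one] at hs
  have hd : derivWithin (D.normalCurve K η x₀ t₀ T) (Set.Icc 0 1) s =
      D.normalCurveVelocity K η x₀ t₀ T s :=
    (D.hasDerivAt_normalCurve K η x₀ t₀ T s).hasDerivWithinAt.derivWithin
      (uniqueDiffOn_Icc one_pos s hs)
  have hs' := hpos s hs
  rw [Riem.speed, hd, hJ.metric_normalCurveVelocity hη hx₀ ht₀ hnorm hs',
    Real.sqrt_sq (by positivity)]

end NormalCurve

section Tube

variable {D : DamekRicci V Z} {W : Submodule ℝ V}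

theorem quarticF_of_mem_slice {q : V × Z × ℝ} (hq : q ∈ slice Z W) : D.quarticF W Wᗮ q = 1 := by
  obtain ⟨hq₀, hq₁, hq₂⟩ := hq
  have ht : q.2.2 ≠ 0 := (show 0 < q.2.2 from hq₀).ne'
  simp [quarticF, Submodule.starProjection_orthogonal_apply_eq_zero hq₁, hq₂, ht]

variable (hJ : D.Swaps W)
include hJ

theorem Swaps.exists_normalCurve_one_eq {p : V × Z × ℝ} (hp : p ∈ halfSpace V Z) {T : ℝ}
    {c : ℝ} (hc : 1 ≤ c) (hF : D.quarticF W Wᗮ p = c ^ 2) (hT : (1 + c) * T ^ 2 = c - 1) :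
    ∃ (K : Z) (η x₀ : V) (t₀ : ℝ), η ∈ Wᗮ ∧ x₀ ∈ W ∧ 0 < t₀ ∧
      ‖η‖ ^ 2 = 4 * t₀ * (T ^ 2 - ‖K‖ ^ 2) ∧ D.normalCurve K η x₀ t₀ T 1 = p := by
  have ht : 0 < p.2.2 := hp
  have hA : 0 < quarticA W p := by rw [quarticA]; positivity
  rw [quarticF_eq, div_eq_iff (by positivity), ← mul_pow, mul_comm] at hF
  obtain ⟨K, hK, hKn⟩ := exists_smul_eq_of_sq_add_norm_sq hA (by positivity) hF
  have hy := norm_starProjection_orthogonal_sq W p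
  set x := W.starProjection p.1
  set y := Wᗮ.starProjection p.1
  have hyW : y ∈ Wᗮ := Wᗮ.starProjection_apply_mem _
  refine ⟨K, (1 + ‖K‖ ^ 2) • y, x - D.J K y, (1 + ‖K‖ ^ 2) * (p.2.2 * (1 + c) / 2),
    Wᗮ.smul_mem _ hyW, W.sub_mem (W.starProjection_apply_mem _) (hJ.2 K y hyW), by positivity,
    ?_, ?_⟩
  · rw [norm_smul, Real.norm_of_nonneg (by positivity), mul_pow, hy]
    linear_combination (1 + ‖K‖ ^ 2) * 2 * hKn - (1 + ‖K‖ ^ 2) * 2 * p.2.2 * hT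
  · rw [normalCurve_one]
    refine Prod.ext ?_ (Prod.ext ?_ ?_)
    · exact W.starProjection_add_starProjection_orthogonal p.1
    · rw [hy, show 2 * (p.2.2 * (1 + c) / 2) + 1 / 2 * (2 * (quarticA W p - p.2.2)) =
        quarticA W p + p.2.2 * c by ring, hK, quarticB]
      exact sub_add_cancel _ _
    · linear_combination (-p.2.2 / 2) * hT

theorem Swaps.exists_dist_le {p : V × Z × ℝ} (hp : p ∈ halfSpace V Z) :
    ∃ q ∈ slice Z W, D.dist p q ≤ Real.arcosh √(D.quarticF W Wᗮ p) := by
  have hF := D.one_le_quarticF W hp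
  set r := Real.arcosh √(D.quarticF W Wᗮ p)
  have hcosh : Real.cosh r = √(D.quarticF W Wᗮ p) := Real.cosh_arcosh (Real.one_le_sqrt.2 hF)
  have hr₀ : 0 ≤ r := Real.arcosh_nonneg (Real.one_le_sqrt.2 hF)
  obtain ⟨K, η, x₀, t₀, hη, hx₀, ht₀, hnorm, hend⟩ := hJ.exists_normalCurve_one_eq hp
    (Real.one_le_cosh r) (by rw [hcosh, Real.sq_sqrt (by linarith)])
    (one_add_cosh_mul_tanh_half_sq r)
  have hq : (x₀, (0 : Z), t₀) ∈ halfSpace V Z := ht₀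
  refine ⟨(x₀, 0, t₀), ⟨hq, hx₀, rfl⟩, ?_⟩
  have hT : 0 ≤ Real.tanh (r / 2) := by
    rw [Real.tanh_eq_sinh_div_cosh]
    exact div_nonneg (Real.sinh_nonneg_iff.2 (div_nonneg hr₀ zero_le_two)) (Real.cosh_pos _).le
  have hdist := hJ.dist_normalCurve_le hη hx₀ ht₀ hT (Real.tanh_lt_one _) hnorm
  rw [hend, Real.artanh_tanh, mul_div_cancel₀ r two_ne_zero] at hdist
  exact (Riem.dist_comm convex_halfSpace D.metric_neg_neg hp hq).trans_le hdist

theorem Swaps.sInf_dist_slice {p : V × Z × ℝ} (hp : p ∈ halfSpace V Z) :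
    sInf ((fun q => D.dist p q) '' slice Z W) = Real.arcosh √(D.quarticF W Wᗮ p) := by
  obtain ⟨q, hq, hpq⟩ := hJ.exists_dist_le hp
  have hlow : ∀ d ∈ (fun q => D.dist p q) '' slice Z W,
      Real.arcosh √(D.quarticF W Wᗮ p) ≤ d := by
    rintro _ ⟨q, hq, rfl⟩
    simpa [quarticF_of_mem_slice hq] using hJ.arcosh_sub_arcosh_le_dist hp hq.1
  exact le_antisymm ((csInf_le ⟨_, hlow⟩ ⟨q, hq, rfl⟩).trans hpq) (le_csInf ⟨_, q, hq, rfl⟩ hlow)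

theorem Swaps.level_eq_tube {r : ℝ} (hr : 0 ≤ r) :
    {p ∈ halfSpace V Z | D.quarticF W Wᗮ p = Real.cosh r ^ 2} = D.tube (slice Z W) r := by
  ext p
  refine and_congr_right fun hp => ?_
  have hF := D.one_le_quarticF W hp
  change _ ↔ sInf ((fun q => D.dist p q) '' slice Z W) = r
  rw [hJ.sInf_dist_slice hp]
  constructor <;> intro h
  · rw [h, Real.sqrt_sq (Real.cosh_pos r).le, Real.arcosh_cosh hr]
  · rw [← h, Real.cosh_arcosh (Real.one_le_sqrt.2 hF), Real.sq_sqrt (zero_le_one.trans hF)]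

end Tube

end DamekRicci

end

theorem proposition6p4_general {V Z : Type*}
    [NormedAddCommGroup V] [InnerProductSpace ℝ V] [FiniteDimensional ℝ V]
    [NormedAddCommGroup Z] [InnerProductSpace ℝ Z] [FiniteDimensional ℝ Z]
    (D : DamekRicci V Z) (v₁ v₂ : Submodule ℝ V) (horth : v₁ ⟂ v₂) (hsum : v₁ ⊔ v₂ = ⊤) :
    (D.IsTransnormal (D.quarticF v₁ v₂) ↔
      (∀ z : Z, ∀ v ∈ v₁, D.J z v ∈ v₂) ∧ (∀ z : Z, ∀ v ∈ v₂, D.J z v ∈ v₁)) ∧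
    (Module.finrank ℝ Z ≠ 0 → (Module.finrank ℝ V ≠ 0 ∨ Module.finrank ℝ Z = 1) →
      (D.IsIsoparametric (D.quarticF v₁ v₂) ↔
        ∃ k : ℕ, 1 ≤ k ∧ ∃ e : D.Iso (DamekRicci.complexHyperbolic k),
          DamekRicci.IsMaximalTotallyReal e v₁)) ∧
    (∀ p ∈ DamekRicci.halfSpace V Z, 1 ≤ D.quarticF v₁ v₂ p) ∧
    (D.IsTransnormal (D.quarticF v₁ v₂) →
      D.IsRealHyperbolicSubspace (Module.finrank ℝ v₁ + 1) (DamekRicci.slice Z v₁) ∧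
      ∀ r : ℝ, 0 ≤ r →
        {p ∈ DamekRicci.halfSpace V Z | D.quarticF v₁ v₂ p = Real.cosh r ^ 2} =
          D.tube (DamekRicci.slice Z v₁) r) := by
  obtain rfl : v₁ᗮ = v₂ := orthogonal_eq_of_isOrtho_of_sup_eq_top horth hsum
  refine ⟨DamekRicci.isTransnormal_quarticF_iff, DamekRicci.isIsoparametric_quarticF_iff,
    fun p hp => D.one_le_quarticF v₁ hp, fun h => ?_⟩
  have hJ : D.Swaps v₁ := DamekRicci.isTransnormal_quarticF_iff.1 h
  exact ⟨DamekRicci.isRealHyperbolicSubspace_slice fun x hx y hy => hJ.bracket_eq_zero hx hy,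
    fun r hr => hJ.level_eq_tube hr⟩

theorem proposition6p4 {V Z : Type*}
    [NormedAddCommGroup V] [InnerProductSpace ℝ V] [FiniteDimensional ℝ V]
    [NormedAddCommGroup Z] [InnerProductSpace ℝ Z] [FiniteDimensional ℝ Z]
    (D : DamekRicci V Z) (v₁ v₂ : Submodule ℝ V) (horth : v₁ ⟂ v₂) (hsum : v₁ ⊔ v₂ = ⊤) :
    (D.IsTransnormal (D.quarticF v₁ v₂) ↔
      (∀ z : Z, ∀ v ∈ v₁, D.J z v ∈ v₂) ∧ (∀ z : Z, ∀ v ∈ v₂, D.J z v ∈ v₁)) ∧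
    (Module.finrank ℝ Z ≠ 0 → (Module.finrank ℝ V ≠ 0 ∨ Module.finrank ℝ Z = 1) →
      (D.IsIsoparametric (D.quarticF v₁ v₂) ↔
        ∃ k : ℕ, 1 ≤ k ∧ ∃ e : D.Iso (DamekRicci.complexHyperbolic k),
          DamekRicci.IsMaximalTotallyReal e v₁)) ∧
    (∀ k : ℕ, 1 ≤ k → ∀ e : D.Iso (DamekRicci.complexHyperbolic k),
      DamekRicci.IsMaximalTotallyReal e v₁ →
        D.IsRealHyperbolicSubspace k (DamekRicci.slice Z v₁) ∧
        (∀ p ∈ DamekRicci.halfSpace V Z, 1 ≤ D.quarticF v₁ v₂ p) ∧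
        ∀ r : ℝ, 0 ≤ r →
          {p ∈ DamekRicci.halfSpace V Z | D.quarticF v₁ v₂ p = Real.cosh r ^ 2} =
            D.tube (DamekRicci.slice Z v₁) r) := by
  obtain rfl : v₁ᗮ = v₂ := orthogonal_eq_of_isOrtho_of_sup_eq_top horth hsum
  obtain ⟨htrans, hiso, hF, htube⟩ := proposition6p4_general D v₁ v₁ᗮ horth hsum
  refine ⟨htrans, hiso, fun k hk e he => ?_⟩
  have hJ : D.Swaps v₁ := (DamekRicci.isMaximalTotallyReal_iff_swaps e).1 he
  rw [← hJ.finrank_add_one_eq hk e]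
  exact ⟨(htube (htrans.2 hJ)).1, hF, (htube (htrans.2 hJ)).2⟩
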